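/- Let $k$ be a field and let $S=k[x,y]$ be $\mathbb{Z}$-graded by $\deg x=\deg y=1$. Let $S\text{-grmod}$ be the abelian category of finitely presented $\mathbb{Z}$-graded $S$-modules (with $S$-linear maps of degree $0$ as morphisms), and let $S\text{-grmod}^0$ be its full subcategory of modules $M$ with $M_{\ge d}=0$ for all sufficiently large $d\in\mathbb{Z}$. Let $S\text{-qfgrmod}$ be the abelian category of quasi finitely generated graded $S$-modules, i.e. of those (not necessarily finitely generated) $\mathbb{Z}$-graded $S$-modules $M$ for which the truncated submodule $M_{\ge d}=\bigoplus_{i\ge d}M_i$ is finitely generated for all sufficiently large $d\in\mathbb{Z}$, and let $S\text{-qfgrmod}^0$ be its full subcategory of modules $M$ with $M_{\ge d}=0$ for all sufficiently large $d$. A non-empty full subcategory $\mathcal{C}$ of an abelian category $\mathcal{A}$ is called thick if it is closed under subobjects, factor objects and extensions; it is called a thick torsion subcategory if, in addition, every object of $\mathcal{A}$ has a maximal subobject belonging to $\mathcal{C}$. A thick subcategory $\mathcal{C}$ is called localizing if the canonical functor $\mathcal{Q}:\mathcal{A}\to\mathcal{A}/\mathcal{C}$ to the Serre quotient has a right adjoint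 (a section functor). Then: 1. $S\text{-grmod}^0\subset S\text{-grmod}$ is a thick torsion subcategory. 2. $S\text{-grmod}^0\subset S\text{-grmod}$ is not localizing: the canonical functor $S\text{-grmod}\to S\text{-grmod}/S\text{-grmod}^0$ has no right adjoint. 3. $S\text{-qfgrmod}^0\subset S\text{-qfgrmod}$ is localizing: it is thick, and the canonical functor $S\text{-qfgrmod}\to S\text{-qfgrmod}/S\text{-qfgrmod}^0$ has a right adjoint. -/

import Mathlib

open CategoryTheory CategoryTheory.Limits Filter

universe u

noncomputable section

/-! ### Graded modules over a standard graded polynomial ring -/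

/-- A `ℤ`-graded module over the polynomial ring `S = A[x_i | i ∈ σ]`, where `S` has the standard
grading `deg x_i = 1`: an `S`-module which is the internal direct sum of additive subgroups
`deg i`, `i ∈ ℤ`, such that `S_n • deg i ⊆ deg (n + i)`. -/
structure GrMod (σ : Type) (A : Type u) [CommRing A] where
  /-- the underlying module -/
  carrier : Type u
  [addCommGroup : AddCommGroup carrier]
  [module : Module (MvPolynomial σ A) carrier]
  /-- the homogeneous component of degree `i` -/
  deg : ℤ → AddSubgroup carrier
  isInternal : DirectSum.IsInternal deg
  smul_mem : ∀ ⦃n : ℕ⦄ ⦃i : ℤ⦄ ⦃s : MvPolynomial σ A⦄ ⦃m : carrier⦄,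
    s.IsHomogeneous n → m ∈ deg i → s • m ∈ deg (n + i)

namespace GrMod

variable {σ : Type} {A : Type u} [CommRing A]

instance : CoeSort (GrMod σ A) (Type u) := ⟨GrMod.carrier⟩

attribute [instance] GrMod.addCommGroup GrMod.module

/-- The projection of a graded module to its component of degree `i`. -/
def proj (M : GrMod σ A) (i : ℤ) : M →+ M :=
  (M.deg i).subtype.comp ((DFinsupp.evalAddMonoidHom (β := fun i => M.deg i) i).comp
    (AddEquiv.ofBijective (DirectSum.coeAddMonoidHom M.deg) M.isInternal).symm.toAddMonoidHom)

lemma proj_coeAddMonoidHom (M : GrMod σ A) (i : ℤ) (z : DirectSum ℤ fun i => M.deg i) :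
    M.proj i (DirectSum.coeAddMonoidHom M.deg z) = z i := by
  have : (AddEquiv.ofBijective (DirectSum.coeAddMonoidHom M.deg) M.isInternal).symm
      (DirectSum.coeAddMonoidHom M.deg z) = z := by
    rw [AddEquiv.symm_apply_eq]; rfl
  exact congrArg (fun w : DirectSum ℤ fun i => M.deg i => (w i : M)) this

lemma proj_mem (M : GrMod σ A) (i : ℤ) (x : M) : M.proj i x ∈ M.deg i := by
  obtain ⟨z, rfl⟩ := M.isInternal.2 x
  rw [proj_coeAddMonoidHom]; exact (z i).2

lemma proj_of_mem (M : GrMod σ A) {i : ℤ} {x : M} (hx : x ∈ M.deg i) : M.proj i x = x := by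
  have := M.proj_coeAddMonoidHom i (DirectSum.of (fun i => M.deg i) i ⟨x, hx⟩)
  rwa [DirectSum.coeAddMonoidHom_of, DirectSum.of_eq_same] at this

lemma proj_of_mem_ne (M : GrMod σ A) {i j : ℤ} (hij : i ≠ j) {x : M} (hx : x ∈ M.deg j) :
    M.proj i x = 0 := by
  have := M.proj_coeAddMonoidHom i (DirectSum.of (fun i => M.deg i) j ⟨x, hx⟩)
  rwa [DirectSum.coeAddMonoidHom_of, DirectSum.of_eq_of_ne _ _ _ hij] at this

lemma exists_eq_sum_proj (M : GrMod σ A) (x : M) : ∃ s : Finset ℤ, x = ∑ i ∈ s, M.proj i x := by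
  classical
  obtain ⟨z, rfl⟩ := M.isInternal.2 x
  refine ⟨z.support, ?_⟩
  simp_rw [proj_coeAddMonoidHom]
  rw [DirectSum.coeAddMonoidHom_eq_dfinsuppSum]
  rfl

lemma isInternal_of_proj {X : Type*} [AddCommGroup X] (D : ℤ → AddSubgroup X) (p : ℤ → X →+ X)
    (h₁ : ∀ i x, x ∈ D i → p i x = x) (h₂ : ∀ i j x, i ≠ j → x ∈ D j → p i x = 0)
    (h₃ : ∀ x, x ∈ ⨆ i, D i) : DirectSum.IsInternal D := by
  have key : ∀ (i : ℤ) (z : DirectSum ℤ fun i => D i),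
      p i (DirectSum.coeAddMonoidHom D z) = z i := by
    intro i z
    induction z using DirectSum.induction_on with
    | zero => simp
    | of j x =>
      rw [DirectSum.coeAddMonoidHom_of]
      by_cases hij : i = j
      · subst hij; rw [h₁ _ _ x.2, DirectSum.of_eq_same]
      · rw [h₂ i j _ hij x.2, DirectSum.of_eq_of_ne _ _ _ hij]; rfl
    | add x y hx hy => rw [map_add, map_add, hx, hy]; rfl
  constructor
  · intro z w hzw
    refine DFinsupp.ext fun i => Subtype.ext ?_
    rw [← key, ← key, hzw]
  · intro x
    induction h₃ x using AddSubgroup.iSup_induction' with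
    | hp i x hx => exact ⟨DirectSum.of (fun i => D i) i ⟨x, hx⟩, by simp⟩
    | h1 => exact ⟨0, map_zero _⟩
    | hadd x y _ _ hx hy =>
      obtain ⟨a, rfl⟩ := hx
      obtain ⟨b, rfl⟩ := hy
      exact ⟨a + b, map_add _ _ _⟩

/-- Morphisms of graded modules: the `S`-linear maps of degree `0`. -/
@[ext]
structure Hom (M N : GrMod σ A) where
  /-- the underlying linear map -/
  lin : M →ₗ[MvPolynomial σ A] N
  map_deg : ∀ ⦃i : ℤ⦄ ⦃x : M⦄, x ∈ M.deg i → lin x ∈ N.deg i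

instance : Category (GrMod σ A) where
  Hom := Hom
  id _ := ⟨LinearMap.id, fun _ _ h => h⟩
  comp f g := ⟨g.lin ∘ₗ f.lin, fun _ _ h => g.map_deg (f.map_deg h)⟩

@[ext]
lemma hom_ext {M N : GrMod σ A} {f g : M ⟶ N} (h : ∀ x, f.lin x = g.lin x) : f = g :=
  Hom.ext (LinearMap.ext h)

@[simp] lemma id_lin (M : GrMod σ A) (x : M) : Hom.lin (𝟙 M) x = x := rfl

@[simp] lemma comp_lin {M N P : GrMod σ A} (f : M ⟶ N) (g : N ⟶ P) (x : M) :
    (f ≫ g).lin x = g.lin (f.lin x) := rfl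

section Preadditive

variable {M N : GrMod σ A}

instance : Zero (M ⟶ N) := ⟨⟨0, fun i _ _ => (N.deg i).zero_mem⟩⟩
instance : Add (M ⟶ N) :=
  ⟨fun f g => ⟨f.lin + g.lin, fun i _ h => (N.deg i).add_mem (f.map_deg h) (g.map_deg h)⟩⟩
instance : Neg (M ⟶ N) := ⟨fun f => ⟨-f.lin, fun i _ h => (N.deg i).neg_mem (f.map_deg h)⟩⟩
instance : Sub (M ⟶ N) :=
  ⟨fun f g => ⟨f.lin - g.lin, fun i _ h => (N.deg i).sub_mem (f.map_deg h) (g.map_deg h)⟩⟩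
instance : SMul ℕ (M ⟶ N) :=
  ⟨fun n f => ⟨n • f.lin, fun i _ h => (N.deg i).nsmul_mem (f.map_deg h) n⟩⟩
instance : SMul ℤ (M ⟶ N) :=
  ⟨fun n f => ⟨n • f.lin, fun i _ h => (N.deg i).zsmul_mem (f.map_deg h) n⟩⟩

lemma lin_injective : Function.Injective (fun f : M ⟶ N => f.lin) := fun _ _ h => Hom.ext h

instance : AddCommGroup (M ⟶ N) :=
  lin_injective.addCommGroup _ rfl (fun _ _ => rfl) (fun _ => rfl) (fun _ _ => rfl)
    (fun _ _ => rfl) (fun _ _ => rfl)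

@[simp] lemma zero_lin (x : M) : Hom.lin (0 : M ⟶ N) x = 0 := rfl
@[simp] lemma add_lin (f g : M ⟶ N) (x : M) : (f + g).lin x = f.lin x + g.lin x := rfl

instance : Preadditive (GrMod σ A) where
  add_comp _ _ _ f f' g := by ext x; simp
  comp_add _ _ _ f g g' := by ext x; simp

end Preadditive

lemma map_proj {M N : GrMod σ A} (f : M ⟶ N) (i : ℤ) (x : M) :
    f.lin (M.proj i x) = N.proj i (f.lin x) := by
  obtain ⟨s, hs⟩ := M.exists_eq_sum_proj x
  rw [hs]
  simp only [map_sum]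
  refine Finset.sum_congr rfl fun j _ => ?_
  by_cases hij : i = j
  · subst hij
    rw [proj_of_mem _ (M.proj_mem i x), proj_of_mem _ (f.map_deg (M.proj_mem i x))]
  · rw [proj_of_mem_ne _ hij (M.proj_mem j x), proj_of_mem_ne _ hij (f.map_deg (M.proj_mem j x)),
      map_zero]

lemma map_proj_of_eq_zero {M N : GrMod σ A} (f : M ⟶ N) {x : M} (hx : f.lin x = 0) (i : ℤ) :
    f.lin (M.proj i x) = 0 := by
  rw [map_proj, hx, map_zero]

/-! ### The category of graded modules is abelian -/

section Kernel

variable {M N : GrMod σ A} (f : M ⟶ N)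

/-- The kernel of a morphism of graded modules. -/
def ker : GrMod σ A where
  carrier := LinearMap.ker f.lin
  deg i := (M.deg i).comap (LinearMap.ker f.lin).subtype.toAddMonoidHom
  isInternal := by
    refine isInternal_of_proj _
      (fun i => ((M.proj i).comp (LinearMap.ker f.lin).subtype.toAddMonoidHom).codRestrict
        (LinearMap.ker f.lin) (fun x => map_proj_of_eq_zero f x.2 i)) ?_ ?_ ?_
    · exact fun i x hx => Subtype.ext (M.proj_of_mem hx)
    · exact fun i j x hij hx => Subtype.ext (M.proj_of_mem_ne hij hx)
    · intro x
      obtain ⟨s, hs⟩ := M.exists_eq_sum_proj x.1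
      have : x = ∑ i ∈ s, (⟨M.proj i x.1, map_proj_of_eq_zero f x.2 i⟩ : LinearMap.ker f.lin) := by
        refine Subtype.ext ?_
        rw [AddSubmonoidClass.coe_finsetSum]
        exact hs
      rw [this]
      exact sum_mem fun i _ => AddSubgroup.mem_iSup_of_mem i (M.proj_mem i x.1)
  smul_mem _ _ _ _ hs hm := M.smul_mem hs hm

/-- The inclusion of the kernel. -/
def kerι : ker f ⟶ M := ⟨(LinearMap.ker f.lin).subtype, fun _ _ h => h⟩

lemma kerι_comp : kerι f ≫ f = 0 := by
  ext x; exact x.2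

/-- The kernel is a categorical kernel. -/
def isLimitKer : IsLimit (KernelFork.ofι (kerι f) (kerι_comp f)) :=
  KernelFork.IsLimit.ofι _ _
    (fun g hg => ⟨g.lin.codRestrict _ (fun x => congrArg (fun h => Hom.lin h x) hg),
      fun _ _ h => g.map_deg h⟩)
    (fun _ _ => rfl)
    (fun g hg m hm => by
      ext x
      exact Subtype.ext (congrArg (fun h => Hom.lin h x) hm))

/-- The cokernel of a morphism of graded modules. -/
def coker : GrMod σ A where
  carrier := N ⧸ LinearMap.range f.lin
  deg i := (N.deg i).map (LinearMap.range f.lin).mkQ.toAddMonoidHom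
  isInternal := by
    have hq : ∀ i, (LinearMap.range f.lin).toAddSubgroup ≤
        (((LinearMap.range f.lin).mkQ.toAddMonoidHom).comp (N.proj i)).ker := by
      rintro i _ ⟨y, rfl⟩
      refine (Submodule.Quotient.mk_eq_zero _).2 ⟨M.proj i y, map_proj f i y⟩
    refine isInternal_of_proj _ (fun i => QuotientAddGroup.lift _ _ (hq i)) ?_ ?_ ?_
    · rintro i _ ⟨y, hy, rfl⟩
      exact congrArg (LinearMap.range f.lin).mkQ (N.proj_of_mem hy)
    · rintro i j _ hij ⟨y, hy, rfl⟩
      exact (congrArg (LinearMap.range f.lin).mkQ (N.proj_of_mem_ne hij hy)).trans (map_zero _)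
    · intro x
      obtain ⟨y, rfl⟩ := Submodule.mkQ_surjective _ x
      obtain ⟨s, hs⟩ := N.exists_eq_sum_proj y
      rw [hs, map_sum]
      exact sum_mem fun i _ => AddSubgroup.mem_iSup_of_mem i ⟨_, N.proj_mem i y, rfl⟩
  smul_mem := by
    rintro n i s _ hs ⟨y, hy, rfl⟩
    exact ⟨s • y, N.smul_mem hs hy, rfl⟩

/-- The projection to the cokernel. -/
def cokerπ : N ⟶ coker f :=
  ⟨(LinearMap.range f.lin).mkQ, fun _ x h => ⟨x, h, rfl⟩⟩

lemma comp_cokerπ : f ≫ cokerπ f = 0 := by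
  ext x; exact (Submodule.Quotient.mk_eq_zero _).2 ⟨x, rfl⟩

lemma cokerπ_surjective : Function.Surjective (cokerπ f).lin := Submodule.mkQ_surjective _

/-- The cokernel is a categorical cokernel. -/
def isColimitCoker : IsColimit (CokernelCofork.ofπ (cokerπ f) (comp_cokerπ f)) :=
  CokernelCofork.IsColimit.ofπ _ _
    (fun g hg => ⟨(LinearMap.range f.lin).liftQ g.lin (by
        rintro _ ⟨x, rfl⟩; exact congrArg (fun h => Hom.lin h x) hg),
      by rintro i _ ⟨y, hy, rfl⟩; exact g.map_deg hy⟩)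
    (fun _ _ => rfl)
    (fun g hg m hm => by
      ext x
      obtain ⟨y, rfl⟩ := cokerπ_surjective f x
      exact congrArg (fun h => Hom.lin h y) hm)

end Kernel

instance : HasKernels (GrMod σ A) := ⟨fun f => ⟨⟨⟨_, isLimitKer f⟩⟩⟩⟩
instance : HasCokernels (GrMod σ A) := ⟨fun f => ⟨⟨⟨_, isColimitCoker f⟩⟩⟩⟩

lemma injective_of_mono {M N : GrMod σ A} (f : M ⟶ N) [Mono f] : Function.Injective f.lin := by
  refine (injective_iff_map_eq_zero _).2 fun x hx => ?_
  have h : kerι f = 0 := by rw [← cancel_mono f, kerι_comp, zero_comp]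
  exact congrArg (fun h : ker f ⟶ M => h.lin (⟨x, hx⟩ : LinearMap.ker f.lin)) h

lemma surjective_of_epi {M N : GrMod σ A} (f : M ⟶ N) [Epi f] : Function.Surjective f.lin := by
  intro x
  have h : cokerπ f = 0 := by rw [← cancel_epi f, comp_cokerπ, comp_zero]
  exact (Submodule.Quotient.mk_eq_zero _).1 (congrArg (fun h => Hom.lin h x) h)

lemma mem_deg_of_injective {M N : GrMod σ A} (f : M ⟶ N) (hf : Function.Injective f.lin)
    {i : ℤ} {x : M} (hx : f.lin x ∈ N.deg i) : x ∈ M.deg i := by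
  have : M.proj i x = x := hf (by rw [map_proj, N.proj_of_mem hx])
  rw [← this]; exact M.proj_mem i x

lemma exists_mem_deg_of_surjective {M N : GrMod σ A} (f : M ⟶ N)
    (hf : Function.Surjective f.lin) {i : ℤ} {y : N} (hy : y ∈ N.deg i) :
    ∃ x ∈ M.deg i, f.lin x = y := by
  obtain ⟨x, rfl⟩ := hf y
  exact ⟨M.proj i x, M.proj_mem i x, by rw [map_proj, N.proj_of_mem hy]⟩

instance : IsNormalMonoCategory (GrMod σ A) where
  normalMonoOfMono {M N} f _ := by
    have hf := injective_of_mono f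
    have aux : ∀ {W : GrMod σ A} (g : W ⟶ N), g ≫ cokerπ f = 0 →
        ∀ x, g.lin x ∈ LinearMap.range f.lin := fun g hg x =>
      (Submodule.Quotient.mk_eq_zero _).1 (congrArg (fun h => Hom.lin h x) hg)
    have aux' : ∀ y, f.lin ((LinearEquiv.ofInjective f.lin hf).symm y) = y := fun y =>
      congrArg Subtype.val ((LinearEquiv.ofInjective f.lin hf).apply_symm_apply y)
    exact ⟨{
      Z := coker f
      g := cokerπ f
      w := comp_cokerπ f
      isLimit := KernelFork.IsLimit.ofι _ _
        (fun g hg => ⟨(LinearEquiv.ofInjective f.lin hf).symm.toLinearMap ∘ₗ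
            g.lin.codRestrict _ (aux g hg), fun i x hx => mem_deg_of_injective f hf (by
              have := aux' ⟨g.lin x, aux g hg x⟩
              exact this ▸ g.map_deg hx)⟩)
        (fun g hg => by ext x; exact aux' ⟨g.lin x, aux g hg x⟩)
        (fun g hg m hm => by
          rw [← cancel_mono f, hm]
          ext x; exact (aux' ⟨g.lin x, aux g hg x⟩).symm) }⟩

instance : IsNormalEpiCategory (GrMod σ A) where
  normalEpiOfEpi {M N} f _ := by
    have hf := surjective_of_epi f
    have aux : ∀ {W : GrMod σ A} (g : M ⟶ W), kerι f ≫ g = 0 →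
        LinearMap.ker f.lin ≤ LinearMap.ker g.lin := fun g hg x hx =>
      congrArg (fun h : ker f ⟶ _ => h.lin (⟨x, hx⟩ : LinearMap.ker f.lin)) hg
    have aux' : ∀ x, (f.lin.quotKerEquivOfSurjective hf).symm (f.lin x) =
        Submodule.Quotient.mk x := fun x => by
      rw [LinearEquiv.symm_apply_eq]; rfl
    have aux'' : ∀ {W : GrMod σ A} (g : M ⟶ W) (hg : kerι f ≫ g = 0) (x : M),
        (LinearMap.ker f.lin).liftQ g.lin (aux g hg)
          ((f.lin.quotKerEquivOfSurjective hf).symm (f.lin x)) = g.lin x := fun g hg x => by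
      rw [aux']; rfl
    exact ⟨{
      W := ker f
      g := kerι f
      w := kerι_comp f
      isColimit := CokernelCofork.IsColimit.ofπ _ _
        (fun g hg => ⟨(LinearMap.ker f.lin).liftQ g.lin (aux g hg) ∘ₗ
            (f.lin.quotKerEquivOfSurjective hf).symm.toLinearMap, fun i y hy => by
              obtain ⟨x, hx, rfl⟩ := exists_mem_deg_of_surjective f hf hy
              have := aux'' g hg x
              exact this.symm ▸ g.map_deg hx⟩)
        (fun g hg => by ext x; exact aux'' g hg x)
        (fun g hg m hm => by
          rw [← cancel_epi f, hm]
          ext x; exact (aux'' g hg x).symm) }⟩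

/-- The zero graded module. -/
def zero : GrMod σ A where
  carrier := PUnit
  deg _ := ⊤
  isInternal := by
    exact isInternal_of_proj _ (fun _ => 0) (fun _ _ _ => rfl) (fun _ _ _ _ _ => rfl)
      (fun _ => AddSubgroup.mem_iSup_of_mem 0 trivial)
  smul_mem := fun _ _ _ _ _ _ => trivial

lemma zero_elim (x : (zero : GrMod σ A)) : x = 0 := rfl

lemma isZero_zero : IsZero (zero : GrMod σ A) :=
  (IsZero.iff_id_eq_zero _).2 (by ext x; rfl)

instance : HasZeroObject (GrMod σ A) := ⟨_, isZero_zero⟩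

section Prod

variable (M N : GrMod σ A)

/-- The direct sum of two graded modules. -/
def prod : GrMod σ A where
  carrier := M × N
  deg i := (M.deg i).prod (N.deg i)
  isInternal := by
    refine isInternal_of_proj _ (fun i => (M.proj i).prodMap (N.proj i)) ?_ ?_ ?_
    · rintro i ⟨x, y⟩ ⟨hx, hy⟩
      exact Prod.ext (M.proj_of_mem hx) (N.proj_of_mem hy)
    · rintro i j ⟨x, y⟩ hij ⟨hx, hy⟩
      exact Prod.ext (M.proj_of_mem_ne hij hx) (N.proj_of_mem_ne hij hy)
    · rintro ⟨x, y⟩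
      obtain ⟨s, hs⟩ := M.exists_eq_sum_proj x
      obtain ⟨t, ht⟩ := N.exists_eq_sum_proj y
      have : (x, y) = ∑ i ∈ s, AddMonoidHom.inl M N (M.proj i x) +
          ∑ i ∈ t, AddMonoidHom.inr M N (N.proj i y) := by
        rw [← map_sum, ← map_sum, ← hs, ← ht]; simp
      rw [this]
      exact add_mem
        (sum_mem fun i _ => AddSubgroup.mem_iSup_of_mem i ⟨M.proj_mem i x, (N.deg i).zero_mem⟩)
        (sum_mem fun i _ => AddSubgroup.mem_iSup_of_mem i ⟨(M.deg i).zero_mem, N.proj_mem i y⟩)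
  smul_mem _ _ _ _ hs hm := ⟨M.smul_mem hs hm.1, N.smul_mem hs hm.2⟩

/-- The direct sum with its projections. -/
def prodFan : BinaryFan M N :=
  BinaryFan.mk (P := prod M N) ⟨LinearMap.fst _ _ _, fun _ _ h => h.1⟩
    ⟨LinearMap.snd _ _ _, fun _ _ h => h.2⟩

/-- The direct sum is a categorical product. -/
def isLimitProdFan : IsLimit (prodFan M N) :=
  BinaryFan.IsLimit.mk _
    (fun f g => ⟨f.lin.prod g.lin, fun _ _ h => ⟨f.map_deg h, g.map_deg h⟩⟩)
    (fun _ _ => rfl) (fun _ _ => rfl)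
    (fun f g m h₁ h₂ => by
      ext x
      exact Prod.ext (congrArg (fun h => Hom.lin h x) h₁) (congrArg (fun h => Hom.lin h x) h₂))

end Prod

instance : HasFiniteProducts (GrMod σ A) := by
  have : ∀ M N : GrMod σ A, HasLimit (pair M N) := fun M N => ⟨⟨⟨_, isLimitProdFan M N⟩⟩⟩
  have : HasBinaryProducts (GrMod σ A) := hasBinaryProducts_of_hasLimit_pair _
  exact hasFiniteProducts_of_has_binary_and_terminal

instance : Abelian (GrMod σ A) where

/-! ### Truncations, finiteness conditions -/

/-- The truncated submodule `M_{≥ d} = ⨁_{i ≥ d} M_i`. -/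
def truncation (M : GrMod σ A) (d : ℤ) : Submodule (MvPolynomial σ A) M where
  __ := ⨆ i : {i : ℤ // d ≤ i}, M.deg i
  smul_mem' := by
    intro s m hm
    change m ∈ ⨆ i : {i : ℤ // d ≤ i}, M.deg i at hm
    change s • m ∈ ⨆ i : {i : ℤ // d ≤ i}, M.deg i
    induction hm using AddSubgroup.iSup_induction' with
    | hp i x hx =>
      rw [← MvPolynomial.sum_homogeneousComponent s, Finset.sum_smul]
      refine sum_mem fun n _ => AddSubgroup.mem_iSup_of_mem ⟨n + i.1, ?_⟩
        (M.smul_mem (MvPolynomial.homogeneousComponent_isHomogeneous n s) hx)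
      have := i.2
      omega
    | h1 => rw [smul_zero]; exact zero_mem _
    | hadd x y _ _ hx hy => rw [smul_add]; exact add_mem hx hy

lemma mem_truncation_of_mem_deg (M : GrMod σ A) {d i : ℤ} (hi : d ≤ i) {x : M}
    (hx : x ∈ M.deg i) : x ∈ M.truncation d :=
  AddSubgroup.mem_iSup_of_mem (S := fun i : {i : ℤ // d ≤ i} => M.deg i) ⟨i, hi⟩ hx

lemma truncation_le_iff (M : GrMod σ A) {d : ℤ} {K : Submodule (MvPolynomial σ A) M} :
    M.truncation d ≤ K ↔ ∀ i, d ≤ i → ∀ x ∈ M.deg i, x ∈ K := by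
  refine ⟨fun h i hi x hx => h (M.mem_truncation_of_mem_deg hi hx), fun h x hx => ?_⟩
  have : (⨆ i : {i : ℤ // d ≤ i}, M.deg i) ≤ K.toAddSubgroup := iSup_le fun i => h i.1 i.2
  exact this hx

variable (σ A)

/-- `S-qfgrmod`: the graded modules which are quasi finitely generated, i.e. `M_{≥ d}` is finitely
generated for all `d` high enough. -/
def quasiFG : ObjectProperty (GrMod σ A) := fun M => ∀ᶠ d : ℤ in atTop, (M.truncation d).FG

/-- `S-grmod`: the finitely presented graded modules. -/
def finPres : ObjectProperty (GrMod σ A) := fun M => Module.FinitePresentation (MvPolynomial σ A) M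

/-- The graded modules with `M_{≥ d} = 0` for all `d` high enough. -/
def boundedAbove : ObjectProperty (GrMod σ A) := fun M => ∀ᶠ d : ℤ in atTop, M.truncation d = ⊥

variable {σ A}

section Closure

variable {M N P : GrMod σ A}

lemma map_truncation_le (f : M ⟶ N) (d : ℤ) :
    (M.truncation d).map f.lin ≤ N.truncation d := by
  rw [Submodule.map_le_iff_le_comap, truncation_le_iff]
  exact fun i hi x hx => N.mem_truncation_of_mem_deg hi (f.map_deg hx)

lemma truncation_le_map (f : M ⟶ N) (hf : Function.Surjective f.lin) (d : ℤ) :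
    N.truncation d ≤ (M.truncation d).map f.lin := by
  rw [truncation_le_iff]
  intro i hi y hy
  obtain ⟨x, hx, rfl⟩ := exists_mem_deg_of_surjective f hf hy
  exact ⟨x, M.mem_truncation_of_mem_deg hi hx, rfl⟩

lemma truncation_prod_le (d : ℤ) :
    (prod M N).truncation d ≤ Submodule.prod (M := M) (M' := N) (M.truncation d) (N.truncation d) :=
  (truncation_le_iff _).2 fun _ hi _ hx =>
    ⟨M.mem_truncation_of_mem_deg hi hx.1, N.mem_truncation_of_mem_deg hi hx.2⟩

variable [Finite σ] [IsNoetherianRing A]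

lemma fg_of_le {X : Type*} [AddCommGroup X] [Module (MvPolynomial σ A) X]
    {K L : Submodule (MvPolynomial σ A) X} (h : K ≤ L) (hL : L.FG) : K.FG := by
  have : Module.Finite (MvPolynomial σ A) L := Module.Finite.iff_fg.2 hL
  have : IsNoetherian (MvPolynomial σ A) L := isNoetherian_of_isNoetherianRing_of_finite _ _
  exact Submodule.FG.of_le hL h

lemma finPres_iff (M : GrMod σ A) :
    finPres σ A M ↔ Module.Finite (MvPolynomial σ A) M :=
  Module.finitePresentation_iff_finite _ _

end Closure

/-- A property of graded modules which is inherited by submodules, quotients and finite direct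
sums. -/
lemma closed_of_constructions (Q : ObjectProperty (GrMod σ A)) (h₀ : Q zero)
    (hmono : ∀ ⦃M N : GrMod σ A⦄ (f : M ⟶ N), Function.Injective f.lin → Q N → Q M)
    (hepi : ∀ ⦃M N : GrMod σ A⦄ (f : M ⟶ N), Function.Surjective f.lin → Q M → Q N)
    (hprod : ∀ M N : GrMod σ A, Q M → Q N → Q (prod M N)) :
    Q.ContainsZero ∧ Q.IsClosedUnderKernels ∧ Q.IsClosedUnderCokernels ∧
      Q.IsClosedUnderFiniteProducts := by
  have : Q.IsClosedUnderSubobjects := ⟨fun f _ h => hmono f (injective_of_mono f) h⟩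
  have : Q.IsClosedUnderQuotients := ⟨fun f _ h => hepi f (surjective_of_epi f) h⟩
  have : Q.ContainsZero := ⟨_, isZero_zero, h₀⟩
  have : Q.IsClosedUnderBinaryProducts := ⟨by
    rintro X ⟨h⟩
    have e := IsLimit.conePointsIsoOfNatIso h.isLimit
      (isLimitProdFan (h.diag.obj ⟨.left⟩) (h.diag.obj ⟨.right⟩)) (diagramIsoPair h.diag)
    exact Q.prop_of_iso e.symm (hprod _ _ (h.prop_diag_obj _) (h.prop_diag_obj _))⟩
  exact ⟨inferInstance, inferInstance, inferInstance, .mk'⟩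

section Instances

variable [Finite σ] [IsNoetherianRing A]

lemma quasiFG_closed : (quasiFG σ A).ContainsZero ∧ (quasiFG σ A).IsClosedUnderKernels ∧
    (quasiFG σ A).IsClosedUnderCokernels ∧ (quasiFG σ A).IsClosedUnderFiniteProducts := by
  refine closed_of_constructions _ ?_ ?_ ?_ ?_
  · refine .of_forall fun d => ⟨∅, ?_⟩
    exact Submodule.ext fun x => ⟨fun _ => zero_mem _, fun _ => by simp [zero_elim x]⟩
  · intro M N f hf hN
    filter_upwards [hN] with d hd
    exact Submodule.fg_of_fg_map_injective f.lin hf (fg_of_le (map_truncation_le f d) hd)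
  · intro M N f hf hM
    filter_upwards [hM] with d hd
    exact fg_of_le (truncation_le_map f hf d) (hd.map _)
  · intro M N hM hN
    filter_upwards [hM, hN] with d hd hd'
    exact fg_of_le (truncation_prod_le d) (Submodule.FG.prod hd hd')

lemma finPres_closed : (finPres σ A).ContainsZero ∧ (finPres σ A).IsClosedUnderKernels ∧
    (finPres σ A).IsClosedUnderCokernels ∧ (finPres σ A).IsClosedUnderFiniteProducts := by
  refine closed_of_constructions _ ?_ ?_ ?_ ?_ <;> simp only [finPres_iff]
  · exact ⟨⟨∅, Submodule.ext fun x => ⟨fun _ => trivial, fun _ => by simp [zero_elim x]⟩⟩⟩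
  · intro M N f hf hN
    exact Module.Finite.of_injective f.lin hf
  · intro M N f hf hM
    exact Module.Finite.of_surjective f.lin hf
  · intro M N hM hN
    exact inferInstanceAs (Module.Finite (MvPolynomial σ A) (M × N))

instance : (quasiFG σ A).ContainsZero := quasiFG_closed.1
instance : (quasiFG σ A).IsClosedUnderKernels := quasiFG_closed.2.1
instance : (quasiFG σ A).IsClosedUnderCokernels := quasiFG_closed.2.2.1
instance : (quasiFG σ A).IsClosedUnderFiniteProducts := quasiFG_closed.2.2.2
instance : (finPres σ A).ContainsZero := finPres_closed.1
instance : (finPres σ A).IsClosedUnderKernels := finPres_closed.2.1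
instance : (finPres σ A).IsClosedUnderCokernels := finPres_closed.2.2.1
instance : (finPres σ A).IsClosedUnderFiniteProducts := finPres_closed.2.2.2

end Instances

end GrMod

/-! ### The two pairs of categories -/

section Pairs

variable (σ : Type) (A : Type u) [CommRing A]

/-- `S-qfgrmod`, the category of quasi finitely generated graded modules over
`S = A[x_i | i ∈ σ]`. -/
abbrev QFGrMod := (GrMod.quasiFG σ A).FullSubcategory

/-- `S-qfgrmod⁰ ⊆ S-qfgrmod`, the quasi finitely generated graded modules `M` with `M_{≥ d} = 0`
for `d` high enough. -/
def QFGrMod.bounded : ObjectProperty (QFGrMod σ A) :=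
  (GrMod.boundedAbove σ A).inverseImage (GrMod.quasiFG σ A).ι

/-- `S-grmod`, the category of finitely presented graded modules over `S = A[x_i | i ∈ σ]`. -/
abbrev FPGrMod := (GrMod.finPres σ A).FullSubcategory

/-- `S-grmod⁰ ⊆ S-grmod`, the finitely presented graded modules `M` with `M_{≥ d} = 0` for `d`
high enough. -/
def FPGrMod.bounded : ObjectProperty (FPGrMod σ A) :=
  (GrMod.boundedAbove σ A).inverseImage (GrMod.finPres σ A).ι

end Pairs

/-! ### Thick, torsion and localizing subcategories -/

section Serre

universe v w

variable {C : Type w} [Category.{v} C] [Abelian C]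

/-- A thick (i.e. Serre) subcategory `P` of the abelian category `C` is a *thick torsion*
subcategory if every object `M` has a maximal subobject belonging to `P`. -/
def IsThickTorsion (P : ObjectProperty C) : Prop :=
  P.IsSerreClass ∧
    ∀ M : C, ∃ H : Subobject M, IsGreatest {K : Subobject M | P (K : C)} H

/-- The Serre quotient `C / P` by a thick subcategory: the localization of `C` at the morphisms
whose kernel and cokernel belong to `P`. -/
abbrev SerreQuotient (P : ObjectProperty C) [P.IsSerreClass] := P.isoModSerre.Localization

/-- The canonical functor `C ⥤ C / P`. -/
abbrev canonicalFunctor (P : ObjectProperty C) [P.IsSerreClass] : C ⥤ SerreQuotient P :=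
  P.isoModSerre.Q

/-- A thick subcategory `P` is *localizing* if the canonical functor `C ⥤ C / P` admits a right
adjoint, called the section functor. -/
def IsLocalizing (P : ObjectProperty C) : Prop :=
  ∃ _ : P.IsSerreClass, ∃ s : SerreQuotient P ⥤ C, Nonempty (canonicalFunctor P ⊣ s)

end Serre

end

/-! A morphism has bounded kernel and cokernel exactly when it is an isomorphism in high degrees.
Call `N` local if `Hom(-, N)` turns such morphisms into bijections. The canonical functor has a
right adjoint as soon as every `M` admits such a morphism to a local object; conversely, a right
adjoint takes only local values.

For quasi finitely generated `M` the local hull is its saturation. It sits inside the product of the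
localizations of `M` at the variables: in degree `i`, it consists of those `z` that all monomials of
some degree `n` carry into the image of `M_{i+n}`. The main point is that `M` and its saturation
agree in high degrees. By noetherianity a graded submodule of a quasi finitely generated module is
again one, so its elements of high degree are combinations of the variables with coefficients in
that same submodule. For the elements killed by all variables this forces vanishing in high degrees,
whence injectivity (`exists_toLoc_injective`). For the Koszul cocycles `X k • a j = X j • a k` it
forces `a j = X j • m`, whence surjectivity (`exists_toLoc_surjective`). Locality is
`saturation_extension`.

The elements dying in all these localizations form the maximal bounded submodule, which gives the
torsion property.

For finitely presented modules, let `A[T]` have every variable acting as `T`. The maps `T ^ n` from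
`A[T]` to its shift by `n` are isomorphisms in high degrees, so a section functor would make the
unit at `A[T]` factor through all of them. The generator of the shift lies in degree `-n`, where a
finitely generated target vanishes for large `n`. So the unit is zero and `A[T]` would be bounded,
which is false. -/

noncomputable section

/-! ### Local objects and adjoints of localization functors -/

namespace CategoryTheory

section Local

universe v₁ v₂ w₁ w₂

variable {C : Type w₁} [Category.{v₁} C] {D : Type w₂} [Category.{v₂} D] (L : C ⥤ D)

/-- If `W` has a calculus of right fractions, then morphisms to a `W`-local object can be computed
in the localized category. -/
lemma MorphismProperty.isLocal.map_bijective (W : MorphismProperty C) [L.IsLocalization W]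
    [W.HasRightCalculusOfFractions] {N : C} (hN : W.isLocal N) (X : C) :
    Function.Bijective (fun f : X ⟶ N => L.map f) := by
  constructor
  · intro f g h
    obtain ⟨Z, s, hs, h⟩ := (MorphismProperty.map_eq_iff_precomp L W f g).1 h
    exact (hN s hs).1 h
  · intro φ
    obtain ⟨ψ, rfl⟩ := Localization.exists_rightFraction L W φ
    -- A morphism of the localization is a roof with backward leg `ψ.s` in `W`; locality of `N`
    -- extends the forward leg `ψ.f` along it.
    obtain ⟨h, hh : ψ.s ≫ h = ψ.f⟩ := (hN ψ.s ψ.hs).2 ψ.f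
    refine ⟨h, ?_⟩
    have := Localization.inverts L W _ ψ.hs
    rw [← cancel_epi (L.map ψ.s), MorphismProperty.RightFraction.map_s_comp_map, ← hh, L.map_comp]

/-- If `W` has a calculus of right fractions and every object admits a morphism in `W` to a
`W`-local object, then the localization functor has a right adjoint. -/
lemma Localization.isLeftAdjoint_of_isLocal (W : MorphismProperty C) [L.IsLocalization W]
    [W.HasRightCalculusOfFractions]
    (h : ∀ M : C, ∃ (N : C) (f : M ⟶ N), W f ∧ W.isLocal N) : L.IsLeftAdjoint := by
  have := Localization.essSurj L W
  have h' : ∀ Y : D, ∃ N : C, W.isLocal N ∧ Nonempty (L.obj N ≅ Y) := fun Y => by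
    obtain ⟨N, f, hf, hN⟩ := h (L.objPreimage Y)
    have := Localization.inverts L W _ hf
    exact ⟨N, hN, ⟨(asIso (L.map f)).symm ≪≫ L.objObjPreimageIso Y⟩⟩
  choose N hN e using h'
  -- `Hom(X, N Y)`, `Hom(L X, L (N Y))` and `Hom(L X, Y)` are identified in turn, so `N` is the
  -- right adjoint on objects.
  let E : ∀ X Y, (L.obj X ⟶ Y) ≃ (X ⟶ N Y) := fun X Y =>
    ((Equiv.ofBijective _ (MorphismProperty.isLocal.map_bijective L W (hN Y) X)).trans
      (Iso.homToEquiv (e Y).some)).symm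
  refine ⟨_, ⟨Adjunction.adjunctionOfEquivRight E fun X' X Y f g => ?_⟩⟩
  rw [Equiv.symm_apply_eq]
  obtain ⟨g, rfl⟩ := (E X Y).symm.surjective g
  simp [E]

/-- The values of a right adjoint of a functor inverting `W` are `W`-local. -/
lemma Adjunction.isLocal_obj {L : C ⥤ D} {R : D ⥤ C} (adj : L ⊣ R) (W : MorphismProperty C)
    (hW : W.IsInvertedBy L) (Y : D) : W.isLocal (R.obj Y) := by
  intro X X' f hf
  have := hW f hf
  -- Under the adjunction, precomposition with `f` becomes precomposition with the isomorphism
  -- `L.map f`.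
  have : (fun g : X' ⟶ R.obj Y => f ≫ g) =
      (((adj.homEquiv X' Y).symm.trans (asIso (L.map f)).symm.homFromEquiv).trans
        (adj.homEquiv X Y)) := by
    ext g
    simp [Adjunction.homEquiv_naturality_left]
  rw [this]
  exact Equiv.bijective _

end Local

end CategoryTheory

/-! ### Modules bounded above as a Serre class; isomorphisms in high degrees -/

namespace GrMod

variable {σ : Type} {A : Type u} [CommRing A]

lemma truncation_eq_bot_iff (M : GrMod σ A) (d : ℤ) :
    M.truncation d = ⊥ ↔ ∀ i, d ≤ i → ∀ x ∈ M.deg i, x = 0 := by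
  rw [← le_bot_iff, truncation_le_iff]
  rfl

lemma boundedAbove_iff (M : GrMod σ A) :
    boundedAbove σ A M ↔ ∃ d : ℤ, ∀ i, d ≤ i → ∀ x ∈ M.deg i, x = 0 := by
  refine (eventually_atTop).trans ⟨fun ⟨d, h⟩ => ⟨d, (truncation_eq_bot_iff M d).1 (h d le_rfl)⟩,
    fun ⟨d, h⟩ => ⟨d, fun e he => (truncation_eq_bot_iff M e).2 fun i hi => h i (he.trans hi)⟩⟩

lemma boundedAbove_of_injective {M N : GrMod σ A} (f : M ⟶ N) (hf : Function.Injective f.lin)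
    (hN : boundedAbove σ A N) : boundedAbove σ A M := by
  rw [boundedAbove_iff] at hN ⊢
  obtain ⟨d, h⟩ := hN
  exact ⟨d, fun i hi x hx => hf ((h i hi _ (f.map_deg hx)).trans (map_zero _).symm)⟩

lemma boundedAbove_of_surjective {M N : GrMod σ A} (f : M ⟶ N)
    (hf : Function.Surjective f.lin) (hM : boundedAbove σ A M) : boundedAbove σ A N := by
  rw [boundedAbove_iff] at hM ⊢
  obtain ⟨d, h⟩ := hM
  refine ⟨d, fun i hi y hy => ?_⟩
  obtain ⟨x, hx, rfl⟩ := exists_mem_deg_of_surjective f hf hy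
  rw [h i hi x hx, map_zero]

lemma boundedAbove_of_exact {M N P : GrMod σ A} (f : M ⟶ N) (g : N ⟶ P)
    (hfg : ∀ y, g.lin y = 0 → ∃ x, f.lin x = y)
    (hM : boundedAbove σ A M) (hP : boundedAbove σ A P) : boundedAbove σ A N := by
  rw [boundedAbove_iff] at hM hP ⊢
  obtain ⟨d, h⟩ := hM
  obtain ⟨e, h'⟩ := hP
  refine ⟨max d e, fun i hi y hy => ?_⟩
  obtain ⟨x, rfl⟩ := hfg y (h' i ((le_max_right _ _).trans hi) _ (g.map_deg hy))
  -- The preimage `x` need not be homogeneous, but its component of degree `i` also maps to `y`, and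
  -- that component vanishes.
  have := map_proj f i x
  rw [N.proj_of_mem hy] at this
  rw [← this, h i ((le_max_left _ _).trans hi) _ (M.proj_mem i x), map_zero]

section Subcategory

variable {Q : ObjectProperty (GrMod σ A)} {M N : Q.FullSubcategory} (f : M ⟶ N)

section

variable [Q.IsClosedUnderKernels]

/-- The kernel of a morphism, as an object of a full subcategory closed under kernels. -/
def subKer : Q.FullSubcategory :=
  ⟨ker f.hom, Q.prop_of_isLimit_kernelFork (isLimitKer f.hom) M.property N.property⟩

/-- The inclusion of the kernel, in a full subcategory closed under kernels. -/
def subKerι : subKer f ⟶ M := ObjectProperty.homMk (kerι f.hom)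

lemma subKerι_comp : subKerι f ≫ f = 0 := by
  ext x
  exact x.2

lemma injective_of_mono_subcategory [Mono f] : Function.Injective f.hom.lin := by
  refine (injective_iff_map_eq_zero _).2 fun x hx => ?_
  have h : subKerι f = 0 := by rw [← cancel_mono f, subKerι_comp, zero_comp]
  exact congrArg (fun h : subKer f ⟶ M => h.hom.lin (⟨x, hx⟩ : LinearMap.ker f.hom.lin)) h

instance : Mono (subKerι f) where
  right_cancellation g h e := by
    ext x
    exact Subtype.ext (congrArg (fun h => h.hom.lin x) e)

end

section

variable [Q.IsClosedUnderCokernels]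

/-- The cokernel of a morphism, as an object of a full subcategory closed under cokernels. -/
def subCoker : Q.FullSubcategory :=
  ⟨coker f.hom, Q.prop_of_isColimit_cokernelCofork (isColimitCoker f.hom) M.property N.property⟩

/-- The projection to the cokernel, in a full subcategory closed under cokernels. -/
def subCokerπ : N ⟶ subCoker f := ObjectProperty.homMk (cokerπ f.hom)

lemma comp_subCokerπ : f ≫ subCokerπ f = 0 :=
  InducedCategory.hom_ext (comp_cokerπ f.hom)

lemma surjective_of_epi_subcategory [Epi f] : Function.Surjective f.hom.lin := by
  intro x
  have h : subCokerπ f = 0 := by rw [← cancel_epi f, comp_subCokerπ, comp_zero]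
  exact (Submodule.Quotient.mk_eq_zero _).1 (congrArg (fun h => h.hom.lin x) h)

instance : Epi (subCokerπ f) where
  left_cancellation g h e := by
    ext x
    obtain ⟨y, rfl⟩ := cokerπ_surjective f.hom x
    exact congrArg (fun h => h.hom.lin y) e

end

variable [Q.ContainsZero] [Q.IsClosedUnderKernels] [Q.IsClosedUnderCokernels]
  [Q.IsClosedUnderFiniteProducts]

variable (Q)

/-- The objects of a full subcategory of graded modules which are bounded above. -/
abbrev bounded : ObjectProperty Q.FullSubcategory := (boundedAbove σ A).inverseImage Q.ι

/-- Stated for every suitably closed full subcategory `Q`, so that one proof serves both the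
finitely presented and the quasi finitely generated modules. -/
instance isSerreClass_bounded : (bounded Q).IsSerreClass where
  exists_zero := by
    obtain ⟨Z, hZ⟩ := HasZeroObject.zero (C := Q.FullSubcategory)
    refine ⟨Z, hZ, (boundedAbove_iff _).2 ⟨0, fun i _ x _ => ?_⟩⟩
    exact congrArg (fun h : Z ⟶ Z => h.hom.lin x) (hZ.eq_of_src (𝟙 Z) 0)
  prop_of_mono f _ h := boundedAbove_of_injective f.hom (injective_of_mono_subcategory f) h
  prop_of_epi f _ h := boundedAbove_of_surjective f.hom (surjective_of_epi_subcategory f) h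
  prop_X₂_of_shortExact {S} hS h₁ h₃ := by
    refine boundedAbove_of_exact S.f.hom S.g.hom (fun y hy => ?_) h₁ h₃
    have := hS.mono_f
    -- Exactness factors the inclusion of the concrete kernel through `S.f`; evaluation at `y`
    -- yields the preimage.
    have e := hS.exact.lift_f (subKerι S.g) (subKerι_comp S.g)
    exact ⟨_, congrArg (fun h : subKer S.g ⟶ S.X₂ =>
      h.hom.lin (⟨y, hy⟩ : LinearMap.ker S.g.hom.lin)) e⟩

variable {Q}

/-- Comparison maps in both directions between the abstract and the concrete kernel are
monomorphisms, and those between the cokernels are epimorphisms. The closure properties of a Serre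
class then transfer boundedness either way. -/
lemma isoModSerre_bounded_iff : (bounded Q).isoModSerre f ↔
    boundedAbove σ A (ker f.hom) ∧ boundedAbove σ A (coker f.hom) := by
  have h₁ : (bounded Q) (kernel f) ↔ (bounded Q) (subKer f) := by
    constructor
    · have := mono_of_mono_fac (kernel.lift_ι f (subKerι f) (subKerι_comp f))
      exact (bounded Q).prop_of_mono (kernel.lift f (subKerι f) (subKerι_comp f))
    · let g : kernel f ⟶ subKer f := ObjectProperty.homMk ((isLimitKer f.hom).lift
        (KernelFork.ofι (kernel.ι f).hom (congrArg (·.hom) (kernel.condition f))))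
      have e : g ≫ subKerι f = kernel.ι f := rfl
      have := mono_of_mono_fac e
      exact (bounded Q).prop_of_mono g
  have h₂ : (bounded Q) (cokernel f) ↔ (bounded Q) (subCoker f) := by
    constructor
    · have := epi_of_epi_fac (cokernel.π_desc f (subCokerπ f) (comp_subCokerπ f))
      exact (bounded Q).prop_of_epi (cokernel.desc f (subCokerπ f) (comp_subCokerπ f))
    · let g : subCoker f ⟶ cokernel f := ObjectProperty.homMk ((isColimitCoker f.hom).desc
        (CokernelCofork.ofπ (cokernel.π f).hom (congrArg (·.hom) (cokernel.condition f))))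
      have e : subCokerπ f ≫ g = cokernel.π f := rfl
      have := epi_of_epi_fac e
      exact (bounded Q).prop_of_epi g
  exact h₁.and h₂

/-- A morphism is an isomorphism modulo the modules which are bounded above if and only if it is
an isomorphism in high degrees. -/
lemma isoModSerre_bounded_iff_exists : (bounded Q).isoModSerre f ↔
    ∃ d : ℤ, ∀ i, d ≤ i → (∀ x ∈ M.obj.deg i, f.hom.lin x = 0 → x = 0) ∧
      ∀ y ∈ N.obj.deg i, ∃ x ∈ M.obj.deg i, f.hom.lin x = y := by
  rw [isoModSerre_bounded_iff, boundedAbove_iff, boundedAbove_iff]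
  constructor
  · rintro ⟨⟨d, h⟩, ⟨e, h'⟩⟩
    refine ⟨max d e, fun i hi => ⟨fun x hx hfx => ?_, fun y hy => ?_⟩⟩
    · exact congrArg Subtype.val
        (h i ((le_max_left _ _).trans hi) (⟨x, hfx⟩ : LinearMap.ker f.hom.lin) hx)
    · obtain ⟨x, hx⟩ := (Submodule.Quotient.mk_eq_zero _).1
        (h' i ((le_max_right _ _).trans hi) _ ((cokerπ f.hom).map_deg hy))
      refine ⟨M.obj.proj i x, M.obj.proj_mem i x, ?_⟩
      rw [map_proj, hx, N.obj.proj_of_mem hy]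
  · rintro ⟨d, h⟩
    refine ⟨⟨d, fun i hi x hx => Subtype.ext ((h i hi).1 _ hx x.2)⟩, ⟨d, ?_⟩⟩
    rintro i hi _ ⟨y, hy, rfl⟩
    obtain ⟨x, -, rfl⟩ := (h i hi).2 y hy
    exact (Submodule.Quotient.mk_eq_zero _).2 ⟨x, rfl⟩

end Subcategory

end GrMod

/-! ### Generation by the variables in high degrees; socle and Koszul cocycles -/

namespace GrMod

variable {σ : Type} {A : Type u} [CommRing A]

open MvPolynomial

lemma X_smul_mem (M : GrMod σ A) (j : σ) {i : ℤ} {m : M} (hm : m ∈ M.deg i) :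
    (X j : MvPolynomial σ A) • m ∈ M.deg (i + 1) := by
  have := M.smul_mem (isHomogeneous_X A j) hm
  rwa [Nat.cast_one, add_comm] at this

lemma X_pow_smul_mem (M : GrMod σ A) (j : σ) (n : ℕ) {i : ℤ} {m : M} (hm : m ∈ M.deg i) :
    (X j ^ n : MvPolynomial σ A) • m ∈ M.deg (i + n) := by
  have := M.smul_mem (isHomogeneous_X_pow j n) hm
  rwa [add_comm] at this

lemma proj_smul (M : GrMod σ A) {n : ℕ} {s : MvPolynomial σ A} (hs : s.IsHomogeneous n)
    (i : ℤ) (m : M) : M.proj (n + i) (s • m) = s • M.proj i m := by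
  obtain ⟨t, ht⟩ := M.exists_eq_sum_proj m
  rw [ht, Finset.smul_sum, map_sum, map_sum, Finset.smul_sum]
  refine Finset.sum_congr rfl fun j _ => ?_
  have h := M.smul_mem hs (M.proj_mem j m)
  by_cases hij : i = j
  · subst hij
    rw [M.proj_of_mem h, M.proj_of_mem (M.proj_mem i m)]
  · rw [M.proj_of_mem_ne (by simpa using hij) h, M.proj_of_mem_ne hij (M.proj_mem j m), smul_zero]

lemma proj_X_smul (M : GrMod σ A) (j : σ) (i : ℤ) (m : M) :
    M.proj i ((X j : MvPolynomial σ A) • m) = (X j : MvPolynomial σ A) • M.proj (i - 1) m := by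
  have := M.proj_smul (isHomogeneous_X A j) (i - 1) m
  rwa [Nat.cast_one, add_sub_cancel] at this

lemma proj_C_smul (M : GrMod σ A) (a : A) (i : ℤ) (m : M) :
    M.proj i ((C a : MvPolynomial σ A) • m) = (C a : MvPolynomial σ A) • M.proj i m := by
  have := M.proj_smul (isHomogeneous_C σ a) i m
  rwa [Nat.cast_zero, zero_add] at this

lemma exists_proj_eq_zero (M : GrMod σ A) (m : M) :
    ∃ d : ℤ, 0 ≤ d ∧ ∀ i, d ≤ |i| → M.proj i m = 0 := by
  obtain ⟨s, hs⟩ := M.exists_eq_sum_proj m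
  obtain ⟨d, hd⟩ := (s.image fun i => |i|).bddAbove
  refine ⟨max (d + 1) 0, le_max_right _ _, fun i hi => ?_⟩
  rw [hs, map_sum]
  refine Finset.sum_eq_zero fun j hj => M.proj_of_mem_ne ?_ (M.proj_mem j m)
  rintro rfl
  have : |i| ≤ d := hd (Finset.mem_coe.2 (Finset.mem_image_of_mem _ hj))
  have := le_max_left (d + 1) 0
  omega

lemma exists_proj_eq_zero_of_finset (M : GrMod σ A) (t : Finset M) :
    ∃ d : ℤ, 0 ≤ d ∧ ∀ m ∈ t, ∀ i, d ≤ |i| → M.proj i m = 0 := by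
  classical
  induction t using Finset.induction_on with
  | empty => exact ⟨0, le_rfl, by simp⟩
  | insert m t _ ih =>
    obtain ⟨d, hd₀, hd⟩ := ih
    obtain ⟨e, -, he⟩ := M.exists_proj_eq_zero m
    refine ⟨max d e, hd₀.trans (le_max_left _ _), fun x hx i hi => ?_⟩
    obtain rfl | hx := Finset.mem_insert.1 hx
    · exact he i ((le_max_right _ _).trans hi)
    · exact hd x hx i ((le_max_left _ _).trans hi)

/-- The submodule of those elements whose homogeneous components of degree at least `d` are
multiples of the variables. -/
def eventuallyGenerated [Finite σ] (M : GrMod σ A) (d : ℤ) :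
    Submodule (MvPolynomial σ A) M where
  carrier := {m | ∀ i, d ≤ i → ∃ b : σ → M, (∀ j, b j ∈ M.deg (i - 1)) ∧
    M.proj i m = ∑ᶠ j, (X j : MvPolynomial σ A) • b j}
  zero_mem' i _ := ⟨0, fun _ => zero_mem _, by simp⟩
  add_mem' {x y} hx hy i hi := by
    obtain ⟨b, hb, hx⟩ := hx i hi
    obtain ⟨c, hc, hy⟩ := hy i hi
    refine ⟨b + c, fun j => add_mem (hb j) (hc j), ?_⟩
    rw [map_add, hx, hy, ← finsum_add_distrib (Set.toFinite _) (Set.toFinite _)]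
    simp [smul_add]
  smul_mem' s m hm := by
    induction s using MvPolynomial.induction_on generalizing m with
    | C a =>
      intro i hi
      obtain ⟨b, hb, h⟩ := hm i hi
      refine ⟨fun j => (C a : MvPolynomial σ A) • b j, fun j => ?_, ?_⟩
      · simpa using M.smul_mem (isHomogeneous_C σ a) (hb j)
      · rw [proj_C_smul, h, smul_finsum' _ (Set.toFinite _)]
        simp only [smul_comm (C a : MvPolynomial σ A)]
    | add p q hp hq =>
      intro i hi
      obtain ⟨b, hb, hx⟩ := hp m hm i hi
      obtain ⟨c, hc, hy⟩ := hq m hm i hi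
      refine ⟨b + c, fun j => add_mem (hb j) (hc j), ?_⟩
      rw [add_smul, map_add, hx, hy, ← finsum_add_distrib (Set.toFinite _) (Set.toFinite _)]
      simp [smul_add]
    | mul_X p n hp =>
      intro i hi
      classical
      -- The component of degree `i` of `X n • p • m` is `X n` times that of degree `i - 1` of `p •
      -- m`, so nothing has to be known in degree `i - 1`, which may lie below `d`.
      refine ⟨Pi.single n (M.proj (i - 1) (p • m)), fun j => ?_, ?_⟩
      · rw [Pi.single_apply]
        split_ifs
        exacts [M.proj_mem _ _, zero_mem _]
      · rw [mul_comm, mul_smul, proj_X_smul, finsum_eq_single _ n]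
        · simp
        · intro j hj
          rw [Pi.single_eq_of_ne hj, smul_zero]

/-- In a quasi finitely generated module, the elements of high degree are multiples of the
variables. -/
lemma exists_eq_finsum_X_smul [Finite σ] {M : GrMod σ A} (hM : quasiFG σ A M) :
    ∃ d : ℤ, ∀ i, d ≤ i → ∀ m ∈ M.deg i, ∃ b : σ → M, (∀ j, b j ∈ M.deg (i - 1)) ∧
      m = ∑ᶠ j, (X j : MvPolynomial σ A) • b j := by
  obtain ⟨e, he⟩ := eventually_atTop.1 hM
  obtain ⟨t, ht⟩ := he e le_rfl
  obtain ⟨d, hd₀, hd⟩ := M.exists_proj_eq_zero_of_finset t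
  -- Finitely many generators have no components in degrees at least `d`, so they satisfy the
  -- condition with `b = 0`.
  have h : M.truncation e ≤ M.eventuallyGenerated d := by
    rw [← ht, Submodule.span_le]
    exact fun m hm i hi => ⟨0, fun _ => zero_mem _, by
      rw [hd m hm i (hi.trans (le_abs_self i))]; simp⟩
  refine ⟨max d e, fun i hi m hm => ?_⟩
  obtain ⟨b, hb, h⟩ := h (M.mem_truncation_of_mem_deg ((le_max_right _ _).trans hi) hm) i
    ((le_max_left _ _).trans hi)
  exact ⟨b, hb, by rw [← h, M.proj_of_mem hm]⟩

/-- A submodule which is closed under taking homogeneous components is a graded module. -/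
def ofSubmodule (M : GrMod σ A) (K : Submodule (MvPolynomial σ A) M)
    (hK : ∀ x ∈ K, ∀ i, M.proj i x ∈ K) : GrMod σ A where
  carrier := K
  deg i := (M.deg i).comap K.subtype.toAddMonoidHom
  isInternal := by
    refine isInternal_of_proj _
      (fun i => ((M.proj i).comp K.subtype.toAddMonoidHom).codRestrict K
        (fun x => hK x x.2 i)) ?_ ?_ ?_
    · exact fun i x hx => Subtype.ext (M.proj_of_mem hx)
    · exact fun i j x hij hx => Subtype.ext (M.proj_of_mem_ne hij hx)
    · intro x
      obtain ⟨s, hs⟩ := M.exists_eq_sum_proj x.1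
      have : x = ∑ i ∈ s, (⟨M.proj i x.1, hK x x.2 i⟩ : K) := by
        refine Subtype.ext ?_
        rw [AddSubmonoidClass.coe_finsetSum]
        exact hs
      rw [this]
      exact sum_mem fun i _ => AddSubgroup.mem_iSup_of_mem i (M.proj_mem i x.1)
  smul_mem _ _ _ _ hs hm := M.smul_mem hs hm

/-- The inclusion of a graded submodule. -/
def ofSubmoduleι (M : GrMod σ A) (K : Submodule (MvPolynomial σ A) M)
    (hK : ∀ x ∈ K, ∀ i, M.proj i x ∈ K) : ofSubmodule M K hK ⟶ M :=
  ⟨K.subtype, fun _ _ h => h⟩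

lemma ofSubmoduleι_injective (M : GrMod σ A) (K : Submodule (MvPolynomial σ A) M)
    (hK : ∀ x ∈ K, ∀ i, M.proj i x ∈ K) : Function.Injective (ofSubmoduleι M K hK).lin :=
  K.subtype_injective

/-- The graded module of functions `σ → M`. -/
def pi [Finite σ] (M : GrMod σ A) : GrMod σ A where
  carrier := σ → M
  deg i := AddSubgroup.pi Set.univ fun _ => M.deg i
  isInternal := by
    refine isInternal_of_proj _ (fun i => (M.proj i).compLeft σ) ?_ ?_ ?_
    · exact fun i x hx => funext fun j => M.proj_of_mem (hx j trivial)
    · exact fun i k x hik hx => funext fun j => M.proj_of_mem_ne hik (hx j trivial)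
    · intro x
      classical
      cases nonempty_fintype σ
      rw [← Finset.univ_sum_single x]
      refine sum_mem fun j _ => ?_
      obtain ⟨s, hs⟩ := M.exists_eq_sum_proj (x j)
      rw [hs, ← AddMonoidHom.single_apply, map_sum]
      refine sum_mem fun i _ => AddSubgroup.mem_iSup_of_mem i fun k _ => ?_
      change _ ∈ M.deg i
      rw [AddMonoidHom.single_apply, Pi.single_apply]
      split_ifs
      exacts [M.proj_mem _ _, zero_mem _]
  smul_mem _ _ _ _ hs hm j _ := M.smul_mem hs (hm j trivial)

lemma proj_pi [Finite σ] (M : GrMod σ A) (i : ℤ) (x : M.pi) (j : σ) :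
    M.pi.proj i x j = M.proj i (x j) := by
  let f : M.pi ⟶ M := ⟨LinearMap.proj j, fun _ _ h => h j trivial⟩
  exact map_proj f i x

section Noetherian

variable [Finite σ] [IsNoetherianRing A]

lemma quasiFG_of_injective {M N : GrMod σ A} (f : M ⟶ N) (hf : Function.Injective f.lin)
    (hN : quasiFG σ A N) : quasiFG σ A M := by
  filter_upwards [hN] with d hd
  exact Submodule.fg_of_fg_map_injective f.lin hf (fg_of_le (map_truncation_le f d) hd)

lemma quasiFG_pi {M : GrMod σ A} (hM : quasiFG σ A M) : quasiFG σ A M.pi := by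
  filter_upwards [hM] with d hd
  have h : M.pi.truncation d ≤
      Submodule.pi (φ := fun _ : σ => M) Set.univ (fun _ : σ => M.truncation d) :=
    (truncation_le_iff _).2 fun _ hi _ hx j _ => M.mem_truncation_of_mem_deg hi (hx j trivial)
  exact fg_of_le h (Submodule.fg_pi fun _ => hd)

/-- The submodule of elements killed by the variables. -/
def socle (M : GrMod σ A) : Submodule (MvPolynomial σ A) M where
  carrier := {m | ∀ j, (X j : MvPolynomial σ A) • m = 0}
  zero_mem' := by simp
  add_mem' hx hy j := by rw [smul_add, hx j, hy j, add_zero]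
  smul_mem' s m hm j := by rw [smul_comm, hm j, smul_zero]

/-- The submodule of families `a` with `X k • a j = X j • a k`. -/
def koszulCocycles (M : GrMod σ A) : Submodule (MvPolynomial σ A) M.pi where
  carrier := {a | ∀ j k, (X k : MvPolynomial σ A) • (a : σ → M) j =
    (X j : MvPolynomial σ A) • (a : σ → M) k}
  zero_mem' j k := by
    change (X k : MvPolynomial σ A) • (0 : M) = (X j : MvPolynomial σ A) • (0 : M)
    simp
  add_mem' {x y} hx hy j k := by
    change (X k : MvPolynomial σ A) • ((x : σ → M) j + (y : σ → M) j) =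
      (X j : MvPolynomial σ A) • ((x : σ → M) k + (y : σ → M) k)
    rw [smul_add, smul_add, hx, hy]
  smul_mem' s x hx j k := by
    change (X k : MvPolynomial σ A) • s • (x : σ → M) j =
      (X j : MvPolynomial σ A) • s • (x : σ → M) k
    rw [smul_comm, hx, smul_comm]

/-- A quasi finitely generated module has no elements of high degree killed by the variables. -/
lemma exists_eq_zero_of_X_smul_eq_zero {M : GrMod σ A} (hM : quasiFG σ A M) :
    ∃ d : ℤ, ∀ i, d ≤ i → ∀ m ∈ M.deg i, (∀ j, (X j : MvPolynomial σ A) • m = 0) → m = 0 := by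
  have hK : ∀ x ∈ M.socle, ∀ i, M.proj i x ∈ M.socle := fun x hx i j => by
    have := M.proj_X_smul j (i + 1) x
    rw [hx j, map_zero, add_sub_cancel_right] at this
    exact this.symm
  -- The socle is itself quasi finitely generated: its elements of high degree are sums of `X j • b
  -- j` with `b j` in the socle, hence zero.
  obtain ⟨d, hd⟩ := exists_eq_finsum_X_smul
    (quasiFG_of_injective (M.ofSubmoduleι _ hK) (M.ofSubmoduleι_injective _ hK) hM)
  refine ⟨d, fun i hi m hm h => ?_⟩
  obtain ⟨b, -, hb⟩ := hd i hi (⟨m, h⟩ : M.socle) hm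
  have : ∀ j, (X j : MvPolynomial σ A) • b j = 0 := fun j =>
    Subtype.ext ((b j : M.socle).2 j)
  simp only [this, finsum_zero] at hb
  exact congrArg Subtype.val hb

/-- In high degrees, the first Koszul cohomology of a quasi finitely generated module vanishes. -/
lemma exists_eq_X_smul {M : GrMod σ A} (hM : quasiFG σ A M) :
    ∃ d : ℤ, ∀ i, d ≤ i → ∀ a : σ → M, (∀ j, a j ∈ M.deg (i + 1)) →
      (∀ j k, (X k : MvPolynomial σ A) • a j = (X j : MvPolynomial σ A) • a k) →
      ∃ m ∈ M.deg i, ∀ j, a j = (X j : MvPolynomial σ A) • m := by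
  have hK : ∀ x ∈ M.koszulCocycles, ∀ i, M.pi.proj i x ∈ M.koszulCocycles := fun x hx i j k => by
    have h := M.proj_X_smul k (i + 1) ((x : σ → M) j)
    have h' := M.proj_X_smul j (i + 1) ((x : σ → M) k)
    rw [add_sub_cancel_right] at h h'
    rw [proj_pi, proj_pi, ← h, ← h', hx]
  obtain ⟨d, hd⟩ := exists_eq_finsum_X_smul (quasiFG_of_injective (M.pi.ofSubmoduleι _ hK)
    (M.pi.ofSubmoduleι_injective _ hK) (quasiFG_pi hM))
  refine ⟨d, fun i hi a ha h => ?_⟩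
  obtain ⟨b, hb, e⟩ := hd (i + 1) (by omega) (⟨a, h⟩ : M.koszulCocycles) fun j _ => ha j
  rw [add_sub_cancel_right] at hb
  let c : σ → σ → M := fun l => (b l : M.koszulCocycles).1
  have hc : ∀ l j k, (X k : MvPolynomial σ A) • c l j = (X j : MvPolynomial σ A) • c l k :=
    fun l => (b l : M.koszulCocycles).2
  have hc' : ∀ l j, c l j ∈ M.deg i := fun l j => hb l j trivial
  cases nonempty_fintype σ
  -- Writing `a` as the sum of `X l • c l` with cocycles `c l`, the cocycle relation gives `X l • c
  -- l j = X j • c l l`, so `X j` can be pulled out of the sum.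
  refine ⟨∑ l, c l l, sum_mem fun l _ => hc' l l, fun j => ?_⟩
  rw [finsum_eq_sum_of_fintype] at e
  have := congrArg (fun z : M.koszulCocycles => (z.1 : σ → M) j) e
  refine this.trans ?_
  let ev : (M.pi.ofSubmodule _ hK) →ₗ[MvPolynomial σ A] M :=
    (LinearMap.proj (φ := fun _ : σ => M) j) ∘ₗ (M.pi.ofSubmoduleι _ hK).lin
  change ev _ = _
  rw [map_sum, Finset.smul_sum]
  refine Finset.sum_congr rfl fun l _ => ?_
  rw [map_smul]
  exact hc l j l

end Noetherian

end GrMod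

/-! ### The saturation -/

namespace GrMod

variable {σ : Type} {A : Type u} [CommRing A]

open MvPolynomial

/-- A variant of `isInternal_of_proj` for situations where projections are not given in advance, as
for the saturation. -/
lemma isInternal_of_sum_eq_zero {X : Type*} [AddCommGroup X] (D : ℤ → AddSubgroup X)
    (h₁ : ∀ (s : Finset ℤ) (z : ℤ → X), (∀ i, z i ∈ D i) → ∑ i ∈ s, z i = 0 → ∀ i ∈ s, z i = 0)
    (h₂ : ∀ x, x ∈ ⨆ i, D i) : DirectSum.IsInternal D := by
  classical
  constructor
  · refine (injective_iff_map_eq_zero _).2 fun z hz => ?_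
    rw [DirectSum.coeAddMonoidHom_eq_dfinsuppSum, DFinsupp.sum] at hz
    have := h₁ _ (fun i => (z i : X)) (fun i => (z i).2) hz
    refine DFinsupp.ext fun i => ?_
    by_cases hi : i ∈ DFinsupp.support z
    · exact Subtype.ext (this i hi)
    · exact DFinsupp.notMem_support_iff.1 hi
  · intro x
    induction h₂ x using AddSubgroup.iSup_induction' with
    | hp i x hx => exact ⟨DirectSum.of (fun i => D i) i ⟨x, hx⟩, by simp⟩
    | h1 => exact ⟨0, map_zero _⟩
    | hadd x y _ _ hx hy =>
      obtain ⟨a, rfl⟩ := hx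
      obtain ⟨b, rfl⟩ := hy
      exact ⟨a + b, map_add _ _ _⟩

/-- The product of the localizations of `M` at the variables. -/
abbrev Loc (M : GrMod σ A) : Type u :=
  ∀ j : σ, LocalizedModule (Submonoid.powers (X j : MvPolynomial σ A)) M

/-- The canonical map to the product of the localizations at the variables. -/
def toLoc (M : GrMod σ A) : M →ₗ[MvPolynomial σ A] M.Loc :=
  LinearMap.pi fun _ => LocalizedModule.mkLinearMap _ _

lemma Loc.eq_zero_of_X_pow_smul {M : GrMod σ A} {z : M.Loc} {j : σ} {n : ℕ}
    (h : ((X j ^ n : MvPolynomial σ A) • z) j = 0) : z j = 0 :=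
  IsLocalizedModule.smul_injective
    (LocalizedModule.mkLinearMap (Submonoid.powers (X j : MvPolynomial σ A)) M)
    (⟨X j ^ n, ⟨n, rfl⟩⟩ : Submonoid.powers (X j : MvPolynomial σ A)) (h.trans (smul_zero _).symm)

lemma Loc.eq_zero_of_X_smul {M : GrMod σ A} {z : M.Loc}
    (h : ∀ j, (X j : MvPolynomial σ A) • z = 0) : z = 0 :=
  funext fun j => Loc.eq_zero_of_X_pow_smul (n := 1) (by rw [pow_one, h j]; rfl)

lemma toLoc_apply_eq_zero_iff (M : GrMod σ A) (m : M) (j : σ) :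
    M.toLoc m j = 0 ↔ ∃ n : ℕ, (X j ^ n : MvPolynomial σ A) • m = 0 := by
  refine (IsLocalizedModule.eq_zero_iff (Submonoid.powers (X j : MvPolynomial σ A))
    (LocalizedModule.mkLinearMap _ M)).trans ?_
  constructor
  · rintro ⟨⟨_, n, rfl⟩, h⟩
    exact ⟨n, h⟩
  · rintro ⟨n, h⟩
    exact ⟨⟨_, n, rfl⟩, h⟩

lemma toLoc_eq_zero_iff (M : GrMod σ A) (m : M) :
    M.toLoc m = 0 ↔ ∀ j, ∃ n : ℕ, (X j ^ n : MvPolynomial σ A) • m = 0 := by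
  simp only [← toLoc_apply_eq_zero_iff, funext_iff]
  rfl

/-- The elements `z` of the product of the localizations at the variables such that `s • z` comes
from an element of `M` of degree `i + n` for all monomials `s` of degree `n`. -/
def satStep (M : GrMod σ A) : ℕ → ℤ → AddSubgroup M.Loc
  | 0, i => (M.deg i).map M.toLoc.toAddMonoidHom
  | n + 1, i => ⨅ j : σ, (satStep M n (i + 1)).comap
      (DistribSMul.toAddMonoidHom M.Loc (X j : MvPolynomial σ A))

lemma mem_satStep_zero {M : GrMod σ A} {i : ℤ} {z : M.Loc} :
    z ∈ M.satStep 0 i ↔ ∃ m ∈ M.deg i, M.toLoc m = z := Iff.rfl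

lemma mem_satStep_succ {M : GrMod σ A} {n : ℕ} {i : ℤ} {z : M.Loc} :
    z ∈ M.satStep (n + 1) i ↔
      ∀ j, (X j : MvPolynomial σ A) • z ∈ M.satStep n (i + 1) := by
  rw [satStep, AddSubgroup.mem_iInf]
  rfl

lemma smul_mem_satStep (M : GrMod σ A) (n : ℕ) {p : ℕ} {s : MvPolynomial σ A}
    (hs : s.IsHomogeneous p) {i : ℤ} {z : M.Loc} (hz : z ∈ M.satStep n i) :
    s • z ∈ M.satStep n (p + i) := by
  induction n generalizing i z with
  | zero =>
    obtain ⟨m, hm, rfl⟩ := hz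
    exact ⟨s • m, M.smul_mem hs hm, M.toLoc.map_smul s m⟩
  | succ n ih =>
    rw [mem_satStep_succ] at hz ⊢
    intro j
    rw [smul_comm, add_assoc]
    exact ih (hz j)

/-- Each step is stable under multiplication by a variable, up to the shift of degree, which is what
membership in the next step requires. -/
lemma satStep_monotone (M : GrMod σ A) (i : ℤ) : Monotone fun n => M.satStep n i := by
  refine monotone_nat_of_le_succ fun n z hz => ?_
  rw [mem_satStep_succ]
  intro j
  have := M.smul_mem_satStep n (isHomogeneous_X A j) hz
  rwa [Nat.cast_one, add_comm] at this

lemma X_pow_smul_of_mem_satStep (M : GrMod σ A) (j : σ) {n : ℕ} {i : ℤ} {z : M.Loc}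
    (hz : z ∈ M.satStep n i) :
    ∃ m ∈ M.deg (i + n), M.toLoc m = (X j ^ n : MvPolynomial σ A) • z := by
  induction n generalizing i z with
  | zero => simpa [mem_satStep_zero] using hz
  | succ n ih =>
    obtain ⟨m, hm, h⟩ := ih (mem_satStep_succ.1 hz j)
    refine ⟨m, ?_, ?_⟩
    · rwa [add_assoc, add_comm (1 : ℤ), ← Nat.cast_succ] at hm
    · rw [h, smul_smul, pow_succ]

/-- The component of degree `i` of the saturation of `M`. -/
def satDeg (M : GrMod σ A) (i : ℤ) : AddSubgroup M.Loc := ⨆ n, M.satStep n i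

lemma mem_satDeg {M : GrMod σ A} {i : ℤ} {z : M.Loc} :
    z ∈ M.satDeg i ↔ ∃ n, z ∈ M.satStep n i :=
  AddSubgroup.mem_iSup_of_directed (M.satStep_monotone i).directed_le

lemma smul_mem_satDeg (M : GrMod σ A) {n : ℕ} {s : MvPolynomial σ A} (hs : s.IsHomogeneous n)
    {i : ℤ} {z : M.Loc} (hz : z ∈ M.satDeg i) : s • z ∈ M.satDeg (n + i) := by
  obtain ⟨p, hp⟩ := mem_satDeg.1 hz
  exact mem_satDeg.2 ⟨p, M.smul_mem_satStep p hs hp⟩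

/-- The localizations carry no grading here. A power of `X j` brings the relation back to `M`, where
it holds up to `X j`-power torsion and can be separated into components; `X j` acts injectively on
the factor `j`. -/
lemma satDeg_independent (M : GrMod σ A) (s : Finset ℤ) (z : ℤ → M.Loc)
    (hz : ∀ i, z i ∈ M.satDeg i) (h : ∑ i ∈ s, z i = 0) : ∀ i ∈ s, z i = 0 := by
  choose n hn using fun i => mem_satDeg.1 (hz i)
  -- A common level, so that the same power `X j ^ N` works for all summands and shifts all degrees
  -- equally.
  have hN : ∀ i ∈ s, z i ∈ M.satStep (s.sup n) i := fun i hi =>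
    M.satStep_monotone i (Finset.le_sup hi) (hn i)
  generalize s.sup n = N at hN
  intro i hi
  refine funext fun j => ?_
  have : ∀ i, ∃ m ∈ M.deg (i + N), i ∈ s → M.toLoc m = (X j ^ N : MvPolynomial σ A) • z i := by
    intro i
    by_cases hi : i ∈ s
    · obtain ⟨m, hm, h⟩ := M.X_pow_smul_of_mem_satStep j (hN i hi)
      exact ⟨m, hm, fun _ => h⟩
    · exact ⟨0, zero_mem _, fun h => absurd h hi⟩
  choose m hm hmz using this
  have h0 : M.toLoc (∑ i ∈ s, m i) = 0 := by
    rw [map_sum, Finset.sum_congr rfl hmz, ← Finset.smul_sum, h, smul_zero]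
  obtain ⟨a, ha⟩ := (M.toLoc_eq_zero_iff _).1 h0 j
  have hi0 : (X j ^ a : MvPolynomial σ A) • m i = 0 := by
    have := M.proj_smul (isHomogeneous_X_pow (R := A) j a) (i + N) (∑ i ∈ s, m i)
    rw [ha, map_zero, map_sum, Finset.sum_eq_single i, M.proj_of_mem (hm i)] at this
    · exact this.symm
    · exact fun k _ hk => M.proj_of_mem_ne (by simpa using hk.symm) (hm k)
    · exact fun h => absurd hi h
  refine Loc.eq_zero_of_X_pow_smul (n := N) ?_
  rw [← hmz i hi]
  exact (M.toLoc_apply_eq_zero_iff _ _).2 ⟨a, hi0⟩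

/-- The saturation of `M`, as a submodule of the product of the localizations. -/
def satSubmodule (M : GrMod σ A) : Submodule (MvPolynomial σ A) M.Loc where
  __ := ⨆ i, M.satDeg i
  smul_mem' := by
    intro s m hm
    change m ∈ ⨆ i, M.satDeg i at hm
    change s • m ∈ ⨆ i, M.satDeg i
    induction hm using AddSubgroup.iSup_induction' with
    | hp i x hx =>
      rw [← MvPolynomial.sum_homogeneousComponent s, Finset.sum_smul]
      exact sum_mem fun n _ => AddSubgroup.mem_iSup_of_mem (n + i)
        (M.smul_mem_satDeg (homogeneousComponent_isHomogeneous n s) hx)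
    | h1 => rw [smul_zero]; exact zero_mem _
    | hadd x y _ _ hx hy => rw [smul_add]; exact add_mem hx hy

lemma satDeg_le (M : GrMod σ A) (i : ℤ) {z : M.Loc} (hz : z ∈ M.satDeg i) :
    z ∈ M.satSubmodule :=
  AddSubgroup.mem_iSup_of_mem (S := M.satDeg) i hz

/-- The saturation of a graded module `M`: the graded module of global sections of the twists of
the sheaf associated with `M`. -/
def saturation (M : GrMod σ A) : GrMod σ A where
  carrier := M.satSubmodule
  deg i := (M.satDeg i).comap M.satSubmodule.subtype.toAddMonoidHom
  isInternal := by
    refine isInternal_of_sum_eq_zero _ (fun s z hz h i hi => Subtype.ext ?_) ?_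
    · refine M.satDeg_independent s (fun i => (z i).1) hz ?_ i hi
      rw [← AddSubmonoidClass.coe_finsetSum, h]
      rfl
    · rintro ⟨z, hz⟩
      have hz' : z ∈ ⨆ i, M.satDeg i := hz
      induction hz' using AddSubgroup.iSup_induction' with
      | hp i x hx => exact AddSubgroup.mem_iSup_of_mem i hx
      | h1 => exact zero_mem _
      | hadd x y hx' hy' hx hy => exact add_mem (hx hx') (hy hy')
  smul_mem _ _ _ _ hs hm := M.smul_mem_satDeg hs hm

lemma toLoc_mem_satDeg (M : GrMod σ A) {i : ℤ} {m : M} (hm : m ∈ M.deg i) :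
    M.toLoc m ∈ M.satDeg i :=
  mem_satDeg.2 ⟨0, m, hm, rfl⟩

lemma toLoc_mem (M : GrMod σ A) (m : M) : M.toLoc m ∈ M.satSubmodule := by
  obtain ⟨s, hs⟩ := M.exists_eq_sum_proj m
  rw [hs, map_sum]
  exact sum_mem fun i _ => M.satDeg_le i (M.toLoc_mem_satDeg (M.proj_mem i m))

/-- The canonical morphism to the saturation. -/
def toSaturation (M : GrMod σ A) : M ⟶ M.saturation :=
  ⟨M.toLoc.codRestrict M.satSubmodule M.toLoc_mem, fun _ _ h => M.toLoc_mem_satDeg h⟩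

section Noetherian

variable [Finite σ] [IsNoetherianRing A]

/-- In high degrees, a quasi finitely generated module has no elements killed by powers of the
variables. -/
lemma exists_toLoc_injective {M : GrMod σ A} (hM : quasiFG σ A M) :
    ∃ d : ℤ, ∀ i, d ≤ i → ∀ m ∈ M.deg i, M.toLoc m = 0 → m = 0 := by
  obtain ⟨d, hd⟩ := exists_eq_zero_of_X_smul_eq_zero hM
  refine ⟨d, fun i hi m hm h => ?_⟩
  rw [toLoc_eq_zero_iff] at h
  choose n hn using h
  cases nonempty_fintype σ
  -- Induction on the sum of the exponents: `X j • m` is killed after lowering the exponent at `j`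
  -- by one, so it vanishes. Then `m` is killed by all variables. If an exponent is `0`, then `m` is
  -- already zero.
  have key : ∀ (p : ℕ) (n : σ → ℕ), ∑ j, n j = p → ∀ i, d ≤ i → ∀ m ∈ M.deg i,
      (∀ j, (X j ^ n j : MvPolynomial σ A) • m = 0) → m = 0 := by
    intro p
    induction p with
    | zero =>
      intro n hp i hi m hm h
      refine hd i hi m hm fun j => ?_
      have h0 : n j = 0 := (Finset.sum_eq_zero_iff.1 hp) j (Finset.mem_univ j)
      have := h j
      rw [h0, pow_zero, one_smul] at this
      rw [this, smul_zero]
    | succ p ih =>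
      classical
      intro n hp i hi m hm h
      refine hd i hi m hm fun j => ?_
      cases hn : n j with
      | zero =>
        have := h j
        rw [hn, pow_zero, one_smul] at this
        rw [this, smul_zero]
      | succ q =>
        refine ih (Function.update n j q) ?_ (i + 1) (by omega) _ (M.X_smul_mem j hm) fun k => ?_
        · have := Finset.add_sum_erase Finset.univ n (Finset.mem_univ j)
          rw [← Finset.add_sum_erase _ _ (Finset.mem_univ j)]
          rw [Function.update_self, Finset.sum_congr rfl (g := fun k => n k)]
          · omega
          · exact fun k hk => Function.update_of_ne (Finset.ne_of_mem_erase hk) _ _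
        · by_cases hk : k = j
          · subst hk
            rw [Function.update_self, smul_smul, ← pow_succ, ← hn, h]
          · rw [Function.update_of_ne hk, smul_comm, h, smul_zero]
  exact key _ n rfl i hi m hm hn

/-- A quasi finitely generated module agrees with its saturation in high degrees. -/
lemma exists_toLoc_surjective {M : GrMod σ A} (hM : quasiFG σ A M) :
    ∃ d : ℤ, ∀ i, d ≤ i → ∀ z ∈ M.satDeg i, z ∈ M.satStep 0 i := by
  obtain ⟨d, hd⟩ := exists_toLoc_injective hM
  obtain ⟨e, he⟩ := exists_eq_X_smul hM
  refine ⟨max d e, fun i hi z hz => ?_⟩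
  obtain ⟨n, hn⟩ := mem_satDeg.1 hz
  clear hz
  induction n generalizing i z with
  | zero => exact hn
  -- The elements `X j • z` have degree `i + 1` and level `n`; the bound on the degree does not
  -- depend on `n`, so the induction may raise the degree.
  | succ n ih =>
    have h : ∀ j, ∃ m ∈ M.deg (i + 1), M.toLoc m = (X j : MvPolynomial σ A) • z := fun j =>
      ih (i + 1) (by omega) _ (mem_satStep_succ.1 hn j)
    choose a ha haz using h
    have hi' := max_le_iff.1 hi
    -- The lifts `a j` of `X j • z` satisfy the cocycle relation in the localizations, hence in `M`
    -- since the degree is high. So `a j = X j • m`, and the difference of `toLoc m` and `z` is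
    -- killed by all variables.
    obtain ⟨m, hm, h⟩ := he i hi'.2 a ha fun j k => sub_eq_zero.1 <|
      hd (i + 1 + 1) (by omega) _ (sub_mem (M.X_smul_mem k (ha j)) (M.X_smul_mem j (ha k))) (by
        rw [map_sub, map_smul, map_smul, haz, haz, smul_comm, sub_self])
    refine mem_satStep_zero.2 ⟨m, hm, sub_eq_zero.1 (Loc.eq_zero_of_X_smul fun j => ?_)⟩
    rw [smul_sub, ← haz, h j, ← map_smul, sub_self]

/-- In high degrees the saturation is the image of `M`. Finite generation itself may be lost in low
degrees: the saturation of `A[T]`, with all variables acting as `T`, is `A[T, T⁻¹]`. -/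
lemma quasiFG_saturation {M : GrMod σ A} (hM : quasiFG σ A M) :
    quasiFG σ A M.saturation := by
  obtain ⟨d, hd⟩ := exists_toLoc_surjective hM
  filter_upwards [hM, eventually_ge_atTop d] with e he hde
  refine fg_of_le (L := (M.truncation e).map M.toSaturation.lin) ?_ (he.map _)
  rw [truncation_le_iff]
  intro i hi z hz
  obtain ⟨m, hm, h⟩ := hd i (hde.trans hi) _ hz
  exact ⟨m, M.mem_truncation_of_mem_deg hi hm, Subtype.ext h⟩

end Noetherian

/-! ### Saturations are local -/

section Extension

variable {M N : GrMod σ A} (f : M ⟶ N) {d : ℤ}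

lemma exists_X_pow_smul_eq_zero (hd : ∀ i, d ≤ i → ∀ x ∈ M.deg i, f.lin x = 0 → x = 0)
    (j : σ) {x : M} (hx : f.lin x = 0) : ∃ n : ℕ, (X j ^ n : MvPolynomial σ A) • x = 0 := by
  obtain ⟨e, he, h⟩ := M.exists_proj_eq_zero x
  obtain ⟨s, hs⟩ := M.exists_eq_sum_proj x
  -- The nonzero components of `x` have degree above `-e`, so this power of `X j` moves them into
  -- degrees at least `d`, where `f` is injective.
  refine ⟨(e + |d|).toNat, ?_⟩
  rw [hs, Finset.smul_sum]
  refine Finset.sum_eq_zero fun i _ => ?_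
  by_cases hi : e ≤ |i|
  · rw [h i hi, smul_zero]
  · refine hd _ ?_ _ (M.X_pow_smul_mem j _ (M.proj_mem i x)) ?_
    · have := neg_abs_le i
      have := le_abs_self d
      have := abs_nonneg d
      omega
    · rw [map_smul, map_proj_of_eq_zero f hx, smul_zero]

lemma exists_X_pow_smul_eq_map (hd : ∀ i, d ≤ i → ∀ y ∈ N.deg i, ∃ x ∈ M.deg i, f.lin x = y)
    (j : σ) (y : N) : ∃ (n : ℕ) (x : M), f.lin x = (X j ^ n : MvPolynomial σ A) • y := by
  obtain ⟨e, he, h⟩ := N.exists_proj_eq_zero y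
  obtain ⟨s, hs⟩ := N.exists_eq_sum_proj y
  refine ⟨(e + |d|).toNat, ?_⟩
  change _ ∈ LinearMap.range f.lin
  rw [hs, Finset.smul_sum]
  refine sum_mem fun i _ => ?_
  by_cases hi : e ≤ |i|
  · rw [h i hi, smul_zero]
    exact zero_mem _
  · obtain ⟨x, -, hx⟩ := hd (i + (e + |d|).toNat) (by
      have := neg_abs_le i
      have := le_abs_self d
      have := abs_nonneg d
      omega) _ (N.X_pow_smul_mem j _ (N.proj_mem i y))
    exact ⟨x, hx⟩

/-- A morphism which is an isomorphism in high degrees becomes an isomorphism after inverting a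
variable. -/
lemma isLocalizedModule_comp
    (hd : ∀ i, d ≤ i → (∀ x ∈ M.deg i, f.lin x = 0 → x = 0) ∧
      ∀ y ∈ N.deg i, ∃ x ∈ M.deg i, f.lin x = y) (j : σ) :
    IsLocalizedModule (Submonoid.powers (X j : MvPolynomial σ A))
      (LocalizedModule.mkLinearMap (Submonoid.powers (X j : MvPolynomial σ A)) N ∘ₗ f.lin) where
  map_units := IsLocalizedModule.map_units (LocalizedModule.mkLinearMap _ N)
  surj z := by
    obtain ⟨⟨y, s⟩, h⟩ := IsLocalizedModule.surj (Submonoid.powers (X j : MvPolynomial σ A))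
      (LocalizedModule.mkLinearMap _ N) z
    obtain ⟨n, x, hx⟩ := exists_X_pow_smul_eq_map f (fun i hi => (hd i hi).2) j y
    refine ⟨⟨x, ⟨X j ^ n, n, rfl⟩ * s⟩, ?_⟩
    rw [mul_smul, h, LinearMap.comp_apply, hx, map_smul]
    rfl
  exists_of_eq {x x'} h := by
    obtain ⟨c, hc⟩ := IsLocalizedModule.exists_of_eq
      (S := Submonoid.powers (X j : MvPolynomial σ A)) (f := LocalizedModule.mkLinearMap _ N)
      (x₁ := f.lin x) (x₂ := f.lin x') h
    obtain ⟨n, hn⟩ := exists_X_pow_smul_eq_zero f (fun i hi => (hd i hi).1) j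
      (x := (c : MvPolynomial σ A) • (x - x')) (by
        rw [map_smul, map_sub, smul_sub, sub_eq_zero]
        exact hc)
    refine ⟨⟨X j ^ n, n, rfl⟩ * c, sub_eq_zero.1 ?_⟩
    rw [← smul_sub, mul_smul]
    exact hn

/-- A linear map to a module on which a variable acts invertibly extends along a morphism which is
an isomorphism in high degrees. -/
lemma exists_extension
    (hd : ∀ i, d ≤ i → (∀ x ∈ M.deg i, f.lin x = 0 → x = 0) ∧
      ∀ y ∈ N.deg i, ∃ x ∈ M.deg i, f.lin x = y) (j : σ) {E : Type u} [AddCommGroup E]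
    [Module (MvPolynomial σ A) E]
    (hE : ∀ s : Submonoid.powers (X j : MvPolynomial σ A),
      IsUnit (algebraMap (MvPolynomial σ A) (Module.End (MvPolynomial σ A) E) s))
    (g : M →ₗ[MvPolynomial σ A] E) :
    ∃ h : N →ₗ[MvPolynomial σ A] E, ∀ x, h (f.lin x) = g x := by
  have := isLocalizedModule_comp f hd j
  exact ⟨IsLocalizedModule.lift (Submonoid.powers (X j : MvPolynomial σ A))
    (LocalizedModule.mkLinearMap (Submonoid.powers (X j : MvPolynomial σ A)) N ∘ₗ f.lin) g hE ∘ₗ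
      LocalizedModule.mkLinearMap _ N,
    fun x => LinearMap.congr_fun (IsLocalizedModule.lift_comp
      (Submonoid.powers (X j : MvPolynomial σ A)) _ g hE) x⟩

variable [Finite σ] [IsNoetherianRing A]

/-- A morphism to a saturation extends uniquely along a morphism which is an isomorphism in
high degrees. -/
lemma saturation_extension {P : GrMod σ A} (hP : quasiFG σ A P)
    (hd : ∀ i, d ≤ i → (∀ x ∈ M.deg i, f.lin x = 0 → x = 0) ∧
      ∀ y ∈ N.deg i, ∃ x ∈ M.deg i, f.lin x = y) :
    Function.Bijective (fun h : N ⟶ P.saturation => f ≫ h) := by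
  constructor
  · intro h h' e
    ext y
    rw [← sub_eq_zero]
    refine Subtype.ext (funext fun j => ?_)
    -- Uniqueness: a power of `X j` carries `y` into the image of `f`, where the two maps agree, and
    -- `X j` acts injectively on the factor `j`.
    obtain ⟨n, x, hx⟩ := exists_X_pow_smul_eq_map f (fun i hi => (hd i hi).2) j y
    refine Loc.eq_zero_of_X_pow_smul (n := n) (congrFun (congrArg Subtype.val
      (?_ : (X j ^ n : MvPolynomial σ A) • (h.lin y - h'.lin y) = 0)) j)
    rw [smul_sub, ← map_smul, ← map_smul, ← hx, sub_eq_zero]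
    exact congrArg (fun h => Hom.lin h x) e
  · intro g
    obtain ⟨e, he⟩ := exists_toLoc_surjective hP
    -- Existence: the extension is made separately in each localization; it remains to see that it
    -- lands in the saturation.
    choose h' hf' using fun j => exists_extension f hd j
      (IsLocalizedModule.map_units (LocalizedModule.mkLinearMap
        (Submonoid.powers (X j : MvPolynomial σ A)) P))
      (LinearMap.proj j ∘ₗ P.satSubmodule.subtype ∘ₗ g.lin)
    let h : N →ₗ[MvPolynomial σ A] P.Loc := LinearMap.pi h'
    have hf : ∀ x, h (f.lin x) = (g.lin x).1 := fun x => funext fun j => hf' j x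
    -- In degrees at least `max d e`, `y` comes from `M` and the saturation comes from `P`, so level
    -- `0` is reached. Each degree further down costs one level.
    have hdeg : ∀ (n : ℕ) (i : ℤ), max d e ≤ i + n → ∀ y ∈ N.deg i, h y ∈ P.satStep n i := by
      intro n
      induction n with
      | zero =>
        intro i hi y hy
        rw [Nat.cast_zero, add_zero] at hi
        obtain ⟨x, hx, rfl⟩ := (hd i ((le_max_left _ _).trans hi)).2 y hy
        rw [hf]
        exact he i ((le_max_right _ _).trans hi) _ (g.map_deg hx)
      | succ n ih =>
        intro i hi y hy
        rw [mem_satStep_succ]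
        intro j
        rw [← map_smul]
        exact ih _ (by push_cast at hi; omega) _ (N.X_smul_mem j hy)
    have hdeg' : ∀ (i : ℤ), ∀ y ∈ N.deg i, h y ∈ P.satDeg i := fun i y hy =>
      mem_satDeg.2 ⟨(max d e - i).toNat, hdeg _ i (by omega) y hy⟩
    have hmem : ∀ y, h y ∈ P.satSubmodule := fun y => by
      obtain ⟨s, hs⟩ := N.exists_eq_sum_proj y
      rw [hs, map_sum]
      exact sum_mem fun i _ => P.satDeg_le i (hdeg' i _ (N.proj_mem i y))
    exact ⟨⟨h.codRestrict _ hmem, fun i y hy => hdeg' i y hy⟩, hom_ext fun x => Subtype.ext (hf x)⟩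

end Extension

end GrMod

/-! ### The section functor on quasi finitely generated modules -/

section Localizing

variable (σ : Type) (A : Type u) [CommRing A] [Finite σ] [IsNoetherianRing A]

/-- The quasi finitely generated graded modules which are bounded above form a localizing
subcategory: the section functor maps a module to its saturation. -/
theorem QFGrMod.isLocalizing_bounded : IsLocalizing (QFGrMod.bounded σ A) := by
  refine ⟨GrMod.isSerreClass_bounded (GrMod.quasiFG σ A), ?_⟩
  have : (QFGrMod.bounded σ A).IsSerreClass := GrMod.isSerreClass_bounded (GrMod.quasiFG σ A)
  have := Localization.isLeftAdjoint_of_isLocal (canonicalFunctor (QFGrMod.bounded σ A))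
    (QFGrMod.bounded σ A).isoModSerre fun M => by
      let N : QFGrMod σ A := ⟨M.obj.saturation, GrMod.quasiFG_saturation M.property⟩
      let f : M ⟶ N := ObjectProperty.homMk M.obj.toSaturation
      refine ⟨N, f, ?_, ?_⟩
      · refine (GrMod.isoModSerre_bounded_iff_exists f).2 ?_
        obtain ⟨d, hd⟩ := GrMod.exists_toLoc_injective M.property
        obtain ⟨e, he⟩ := GrMod.exists_toLoc_surjective M.property
        refine ⟨max d e, fun i hi => ⟨fun x hx h => ?_, fun y hy => ?_⟩⟩
        · exact hd i ((le_max_left _ _).trans hi) x hx (congrArg Subtype.val h)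
        · obtain ⟨x, hx, h⟩ := he i ((le_max_right _ _).trans hi) _ hy
          exact ⟨x, hx, Subtype.ext h⟩
      · intro X Y g hg
        obtain ⟨d, hd⟩ := (GrMod.isoModSerre_bounded_iff_exists g).1 hg
        have h := GrMod.saturation_extension g.hom M.property hd
        constructor
        · intro a b hab
          exact InducedCategory.hom_ext (h.1 (congrArg (·.hom) hab))
        · intro a
          obtain ⟨b, hb⟩ := h.2 a.hom
          exact ⟨ObjectProperty.homMk b, InducedCategory.hom_ext hb⟩
  exact ⟨_, ⟨Adjunction.ofIsLeftAdjoint _⟩⟩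

end Localizing

/-! ### The maximal bounded submodule -/

namespace GrMod

variable {σ : Type} {A : Type u} [CommRing A]

open MvPolynomial

lemma proj_mem_ker_toLoc (M : GrMod σ A) (x : M) (hx : x ∈ LinearMap.ker M.toLoc) (i : ℤ) :
    M.proj i x ∈ LinearMap.ker M.toLoc := by
  rw [LinearMap.mem_ker, toLoc_eq_zero_iff] at hx ⊢
  intro j
  obtain ⟨n, hn⟩ := hx j
  have := M.proj_smul (isHomogeneous_X_pow (R := A) j n) i x
  rw [hn, map_zero] at this
  exact ⟨n, this.symm⟩

/-- The graded submodule of elements killed by powers of the variables. -/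
def torsion (M : GrMod σ A) : GrMod σ A :=
  M.ofSubmodule (LinearMap.ker M.toLoc) M.proj_mem_ker_toLoc

/-- This gives maximality of the torsion submodule: if `K` vanishes from degree `d` on, a large
power of any variable pushes each homogeneous element beyond `d`. -/
lemma toLoc_lin_eq_zero_of_boundedAbove {K M : GrMod σ A} (f : K ⟶ M)
    (hK : boundedAbove σ A K) (x : K) : M.toLoc (f.lin x) = 0 := by
  obtain ⟨d, hd⟩ := (boundedAbove_iff K).1 hK
  obtain ⟨s, hs⟩ := K.exists_eq_sum_proj x
  rw [hs, map_sum, map_sum]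
  refine Finset.sum_eq_zero fun i _ => (M.toLoc_eq_zero_iff _).2 fun j => ⟨(d - i).toNat, ?_⟩
  rw [← map_smul, hd _ _ _ (K.X_pow_smul_mem j _ (K.proj_mem i x)), map_zero]
  omega

lemma boundedAbove_torsion [Finite σ] [IsNoetherianRing A] {M : GrMod σ A}
    (hM : quasiFG σ A M) : boundedAbove σ A M.torsion := by
  obtain ⟨d, hd⟩ := exists_toLoc_injective hM
  exact (boundedAbove_iff _).2 ⟨d, fun i hi x hx => Subtype.ext (hd i hi _ hx x.2)⟩

lemma quasiFG_of_finPres [Finite σ] [IsNoetherianRing A] {M : GrMod σ A}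
    (hM : finPres σ A M) : quasiFG σ A M := by
  rw [finPres_iff] at hM
  exact .of_forall fun d => fg_of_le le_top hM.fg_top

end GrMod

/-- The finitely presented graded modules which are bounded above form a thick torsion
subcategory. -/
theorem FPGrMod.isThickTorsion_bounded (σ : Type) (A : Type u) [CommRing A] [Finite σ]
    [IsNoetherianRing A] : IsThickTorsion (FPGrMod.bounded σ A) := by
  have hS : (FPGrMod.bounded σ A).IsSerreClass := GrMod.isSerreClass_bounded (GrMod.finPres σ A)
  refine ⟨hS, fun M => ?_⟩
  have hfin : Module.Finite (MvPolynomial σ A) M.obj := (GrMod.finPres_iff _).1 M.property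
  let T : FPGrMod σ A := ⟨M.obj.torsion, (GrMod.finPres_iff _).2
    (Module.Finite.of_injective (LinearMap.ker M.obj.toLoc).subtype (Submodule.subtype_injective _))⟩
  let ι : T ⟶ M := ObjectProperty.homMk (GrMod.ofSubmoduleι _ _ M.obj.proj_mem_ker_toLoc)
  have : Mono ι := ⟨fun g h e => by
    ext x
    exact Subtype.ext (congrArg (fun h => h.hom.lin x) e)⟩
  refine ⟨Subobject.mk ι, ?_, fun K hK => ?_⟩
  · exact (FPGrMod.bounded σ A).prop_of_iso (Subobject.underlyingIso ι).symm
      (GrMod.boundedAbove_torsion (GrMod.quasiFG_of_finPres M.property))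
  · refine Subobject.le_mk_of_comm (ObjectProperty.homMk
      ⟨K.arrow.hom.lin.codRestrict _ (GrMod.toLoc_lin_eq_zero_of_boundedAbove K.arrow.hom hK),
        fun _ _ h => K.arrow.hom.map_deg h⟩) rfl

/-! ### Shifts of `A[T]` and the absence of a section functor -/

namespace GrMod

variable {σ : Type} {A : Type u} [CommRing A]

open MvPolynomial

/-- The submodule of elements without components of degree less than `-d`. -/
def boundedBelow (M : GrMod σ A) (d : ℤ) : Submodule (MvPolynomial σ A) M where
  carrier := {m | ∀ i, i < -d → M.proj i m = 0}
  zero_mem' _ _ := map_zero _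
  add_mem' hx hy i hi := by rw [map_add, hx i hi, hy i hi, add_zero]
  smul_mem' s m hm := by
    induction s using MvPolynomial.induction_on generalizing m with
    | C a => exact fun i hi => by rw [proj_C_smul, hm i hi, smul_zero]
    | add p q hp hq =>
      exact fun i hi => by rw [add_smul, map_add, hp m hm i hi, hq m hm i hi, add_zero]
    | mul_X p n hp =>
      intro i hi
      rw [mul_comm, mul_smul, proj_X_smul, hp m hm (i - 1) (by omega), smul_zero]

/-- A finitely generated graded module vanishes in very negative degrees. -/
lemma exists_eq_zero_of_lt (M : GrMod σ A) [Module.Finite (MvPolynomial σ A) M] :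
    ∃ d : ℤ, ∀ i, i < -d → ∀ m ∈ M.deg i, m = 0 := by
  obtain ⟨t, ht⟩ := Module.Finite.fg_top (R := MvPolynomial σ A) (M := M)
  obtain ⟨d, hd₀, hd⟩ := M.exists_proj_eq_zero_of_finset t
  have h : ⊤ ≤ M.boundedBelow d := by
    rw [← ht, Submodule.span_le]
    intro m hm i hi
    exact hd m hm i (by have := neg_le_abs i; omega)
  exact ⟨d, fun i hi m hm => (M.proj_of_mem hm).symm.trans (h trivial i hi)⟩

section Line

-- Every monomial of degree `n` is sent to `T ^ n`. This makes the action on `A[T]` compatible with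
-- the grading.
open Polynomial in
lemma exists_aeval_eq_monomial {n : ℕ} {s : MvPolynomial σ A} (hs : s.IsHomogeneous n) :
    ∃ a : A, MvPolynomial.aeval (fun _ : σ => (Polynomial.X : A[X])) s = monomial n a := by
  rw [s.as_sum, map_sum]
  refine Finset.sum_induction _ (fun p : A[X] => ∃ a : A, p = monomial n a) ?_ ?_ ?_
  · rintro _ _ ⟨a, rfl⟩ ⟨b, rfl⟩
    exact ⟨a + b, (map_add _ _ _).symm⟩
  · exact ⟨0, (map_zero _).symm⟩
  · intro e he
    refine ⟨MvPolynomial.coeff e s, ?_⟩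
    rw [MvPolynomial.aeval_monomial, Finsupp.prod, Finset.prod_pow_eq_pow_sum]
    have : ∑ i ∈ e.support, e i = n := by
      rw [← hs (MvPolynomial.mem_support_iff.1 he), Finsupp.weight_apply, Finsupp.sum]
      simp
    rw [this, Polynomial.algebraMap_eq, Polynomial.C_mul_X_pow_eq_monomial]

variable (σ A)

open Polynomial in
/-- The shift by `c` of the graded module `A[T]`, on which all variables act as `T`. -/
def line (c : ℤ) : GrMod σ A :=
  letI : Module (MvPolynomial σ A) A[X] :=
    Module.compHom _ (MvPolynomial.aeval (fun _ : σ => (Polynomial.X : A[X]))).toRingHom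
  { carrier := A[X]
    deg := fun i =>
      -- With this convention `T ^ m` has degree `m - c`, so the generator `1` lies in degree `-c`.
      { carrier := {p | ∀ m : ℕ, (m : ℤ) ≠ i + c → p.coeff m = 0}
        zero_mem' := fun _ _ => Polynomial.coeff_zero _
        add_mem' := fun hx hy m hm => by rw [Polynomial.coeff_add, hx m hm, hy m hm, add_zero]
        neg_mem' := fun hx m hm => by rw [Polynomial.coeff_neg, hx m hm, neg_zero] }
    isInternal := by
      refine isInternal_of_sum_eq_zero _ (fun s z hz h i hi => ?_) fun p => ?_
      · ext m
        rw [Polynomial.coeff_zero]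
        by_cases hm : (m : ℤ) = i + c
        · have := congrArg (Polynomial.coeff · m) h
          simp only [Polynomial.finsetSum_coeff, Polynomial.coeff_zero] at this
          rwa [Finset.sum_eq_single_of_mem i hi] at this
          exact fun k _ hk => hz k m (by rw [hm]; simpa using hk.symm)
        · exact hz i m hm
      · induction p using Polynomial.induction_on' with
        | add p q hp hq => exact add_mem hp hq
        | monomial n a =>
          refine AddSubgroup.mem_iSup_of_mem ((n : ℤ) - c) fun m hm => ?_
          rw [Polynomial.coeff_monomial, if_neg]
          rintro rfl
          simp at hm
    smul_mem := by
      intro n i s p hs hp m hm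
      obtain ⟨a, ha⟩ := exists_aeval_eq_monomial hs
      change Polynomial.coeff (MvPolynomial.aeval (fun _ : σ => (Polynomial.X : A[X])) s * p) m = 0
      rw [ha, ← Polynomial.C_mul_X_pow_eq_monomial, mul_assoc, Polynomial.coeff_C_mul, Polynomial.coeff_X_pow_mul']
      split_ifs with h
      · rw [hp, mul_zero]
        intro h'
        apply hm
        omega
      · rw [mul_zero] }

variable {σ A}

/-- The identification of `A[T]` with the module `line σ A c`. -/
def line.mk (c : ℤ) : Polynomial A ≃+ line σ A c := AddEquiv.refl (Polynomial A)

lemma line.smul_mk (c : ℤ) (s : MvPolynomial σ A) (p : Polynomial A) :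
    s • (line.mk c p : line σ A c) =
      line.mk c (aeval (fun _ : σ => (Polynomial.X : Polynomial A)) s * p) := rfl

lemma line.mk_mem_deg {c i : ℤ} {p : Polynomial A} :
    (line.mk c p : line σ A c) ∈ (line σ A c).deg i ↔
      ∀ m : ℕ, (m : ℤ) ≠ i + c → p.coeff m = 0 := Iff.rfl

lemma line.X_pow_smul (c : ℤ) (j : σ) (n : ℕ) (p : Polynomial A) :
    (X j ^ n : MvPolynomial σ A) • (line.mk c p : line σ A c) =
      line.mk c (Polynomial.X ^ n * p) := by
  rw [line.smul_mk, map_pow, aeval_X]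

lemma line.exists_smul_one [Nonempty σ] (c : ℤ) (p : line σ A c) :
    ∃ s : MvPolynomial σ A, s • (line.mk c 1 : line σ A c) = p := by
  obtain ⟨j⟩ := ‹Nonempty σ›
  obtain ⟨p, rfl⟩ := (line.mk c).surjective p
  refine ⟨Polynomial.aeval (X j : MvPolynomial σ A) p, ?_⟩
  rw [line.smul_mk, mul_one, ← Polynomial.aeval_algHom_apply, aeval_X,
    Polynomial.aeval_X_left_apply]

lemma finite_line [Nonempty σ] (c : ℤ) : Module.Finite (MvPolynomial σ A) (line σ A c) :=
  ⟨⟨{line.mk c 1}, by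
    rw [Finset.coe_singleton, Submodule.eq_top_iff']
    exact fun p => Submodule.mem_span_singleton.2 (line.exists_smul_one c p)⟩⟩

/-- Multiplication by `T ^ n`, as a morphism of degree zero to the shift by `n`. -/
def lineMap (n : ℕ) : line σ A 0 ⟶ line σ A n where
  lin :=
    { toFun := fun p => line.mk n (Polynomial.X ^ n * (line.mk 0).symm p)
      map_add' := fun p q => by rw [map_add, mul_add, map_add]
      map_smul' := fun s p => by
        obtain ⟨p, rfl⟩ := (line.mk 0).surjective p
        rw [line.smul_mk, AddEquiv.symm_apply_apply, AddEquiv.symm_apply_apply, mul_left_comm,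
          RingHom.id_apply, line.smul_mk] }
  map_deg := by
    intro i p hp
    obtain ⟨p, rfl⟩ := (line.mk 0).surjective p
    rw [line.mk_mem_deg] at hp
    refine line.mk_mem_deg.2 fun m hm => ?_
    rw [AddEquiv.symm_apply_apply, Polynomial.coeff_X_pow_mul']
    split_ifs with h
    · exact hp _ (by omega)
    · rfl

lemma lineMap_mk (n : ℕ) (p : Polynomial A) :
    (lineMap n).lin (line.mk 0 p : line σ A 0) = line.mk n (Polynomial.X ^ n * p) := rfl

/-- Multiplication by `T ^ n` is injective. In degree `i ≥ 0` the target consists of multiples of `T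
^ (i + n)`, which are divisible by `T ^ n`. -/
lemma lineMap_isIso_in_high_degrees (n : ℕ) (i : ℤ) (hi : 0 ≤ i) :
    (∀ x ∈ (line σ A 0).deg i, (lineMap n).lin x = 0 → x = 0) ∧
      ∀ y ∈ (line σ A n).deg i, ∃ x ∈ (line σ A 0).deg i, (lineMap n).lin x = y := by
  constructor
  · intro p _ h
    obtain ⟨p, rfl⟩ := (line.mk 0).surjective p
    rw [lineMap_mk, EmbeddingLike.map_eq_zero_iff] at h
    rw [EmbeddingLike.map_eq_zero_iff]
    refine Polynomial.ext fun m => ?_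
    rw [← Polynomial.coeff_X_pow_mul p n m, h, Polynomial.coeff_zero, Polynomial.coeff_zero]
  · intro q hq
    obtain ⟨q, rfl⟩ := (line.mk n).surjective q
    rw [line.mk_mem_deg] at hq
    obtain ⟨p, rfl⟩ : (Polynomial.X ^ n : Polynomial A) ∣ q :=
      Polynomial.X_pow_dvd_iff.2 fun m hm => hq m (by omega)
    refine ⟨line.mk 0 p, line.mk_mem_deg.2 fun m hm => ?_, lineMap_mk n p⟩
    rw [← Polynomial.coeff_X_pow_mul p n m]
    exact hq _ (by push_cast; omega)

lemma not_boundedAbove_line [Nontrivial A] : ¬ boundedAbove σ A (line σ A 0) := by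
  rw [boundedAbove_iff]
  rintro ⟨d, hd⟩
  have h : (line.mk 0 (Polynomial.X ^ d.toNat) : line σ A 0) = 0 := by
    refine hd d.toNat (by omega) _ (line.mk_mem_deg.2 fun m hm => ?_)
    rw [Polynomial.coeff_X_pow, if_neg]
    rintro rfl
    simp at hm
  rw [EmbeddingLike.map_eq_zero_iff] at h
  have := congrArg (fun q : Polynomial A => q.coeff d.toNat) h
  simp at this

end Line

end GrMod

/-- The finitely presented graded modules which are bounded above do not form a localizing
subcategory. -/
theorem FPGrMod.not_isLocalizing_bounded (σ : Type) (A : Type u) [CommRing A] [Finite σ]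
    [Nonempty σ] [IsNoetherianRing A] [Nontrivial A] :
    ¬ IsLocalizing (FPGrMod.bounded σ A) := by
  rintro ⟨hS, s, ⟨adj⟩⟩
  let L : ℕ → FPGrMod σ A := fun n =>
    ⟨GrMod.line σ A n, (GrMod.finPres_iff _).2 (GrMod.finite_line _)⟩
  let M : FPGrMod σ A := ⟨GrMod.line σ A 0, (GrMod.finPres_iff _).2 (GrMod.finite_line _)⟩
  let f : ∀ n, M ⟶ L n := fun n => ObjectProperty.homMk (GrMod.lineMap n)
  have hf : ∀ n, (FPGrMod.bounded σ A).isoModSerre (f n) := fun n =>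
    (GrMod.isoModSerre_bounded_iff_exists (f n)).2 ⟨0, GrMod.lineMap_isIso_in_high_degrees n⟩
  let N : FPGrMod σ A := s.obj ((canonicalFunctor (FPGrMod.bounded σ A)).obj M)
  let η : M ⟶ N := adj.unit.app M
  have hN : (FPGrMod.bounded σ A).isoModSerre.isLocal N :=
    adj.isLocal_obj _ (Localization.inverts _ _) _
  -- If the unit killed the generator it would be zero; the triangle identity would then make the
  -- image of `M` in the quotient zero, so that `M` would be bounded above.
  have hη : η.hom.lin (GrMod.line.mk 0 1 : GrMod.line σ A 0) ≠ 0 := by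
    intro h
    have h0 : η = 0 := by
      ext x
      obtain ⟨r, rfl⟩ := GrMod.line.exists_smul_one 0 x
      rw [map_smul, h, smul_zero]
      rfl
    have h1 := adj.left_triangle_components M
    rw [show adj.unit.app M = 0 from h0, Functor.map_zero, zero_comp] at h1
    exact GrMod.not_boundedAbove_line ((ObjectProperty.SerreClassLocalization.isZero_obj_iff
      (canonicalFunctor (FPGrMod.bounded σ A)) (FPGrMod.bounded σ A) M).1
        ((IsZero.iff_id_eq_zero _).2 h1.symm))
  have : Module.Finite (MvPolynomial σ A) N.obj := (GrMod.finPres_iff _).1 N.property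
  obtain ⟨d, hd⟩ := N.obj.exists_eq_zero_of_lt
  -- Chosen so that `-n < -d`: the generator of `L n` has degree `-n`, where `N` vanishes.
  let n : ℕ := (d + 1).toNat
  obtain ⟨h, hh⟩ := (hN (f n) (hf n)).2 η
  obtain ⟨j⟩ := ‹Nonempty σ›
  have h1 : h.hom.lin (GrMod.line.mk n 1 : GrMod.line σ A n) = 0 := by
    refine hd (-n) (by omega) _ (h.hom.map_deg (GrMod.line.mk_mem_deg.2 fun m hm => ?_))
    rw [Polynomial.coeff_one, if_neg]
    rintro rfl
    simp at hm
  apply hη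
  rw [← hh]
  change h.hom.lin ((GrMod.lineMap n).lin (GrMod.line.mk 0 1 : GrMod.line σ A 0)) = 0
  -- The image of `1` in `L n` is `T ^ n`, that is `X j ^ n` times the generator, which `h` kills.
  rw [GrMod.lineMap_mk, ← GrMod.line.X_pow_smul _ j, map_smul, h1, smul_zero]

end

theorem mainTheorem5 (k : Type u) [Field k] :
    IsThickTorsion (FPGrMod.bounded (Fin 2) k) ∧
    ¬ IsLocalizing (FPGrMod.bounded (Fin 2) k) ∧
    IsLocalizing (QFGrMod.bounded (Fin 2) k) :=
  ⟨FPGrMod.isThickTorsion_bounded _ _, FPGrMod.not_isLocalizing_bounded _ _,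
    QFGrMod.isLocalizing_bounded _ _⟩
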